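/- **Setting (graphs).** Let $V$ be a finite set with at least two elements and let $G_j=(V,E_j,m_j,\mu_j)$, $j=1,\dots,N$, be weighted simple graphs on $V$, with (possibly different) edge sets $E_j$, vertex weights $m_j:V\to(0,\infty)$ and edge weights $\mu_j:E_j\to(0,\infty)$. The Laplacian of $G_j$ is $$\mathcal L_j f(v)=\frac1{m_j(v)}\sum_{w:\{v,w\}\in E_j}\mu_j(\{v,w\})\,(f(w)-f(v)),\qquad f\in\mathbb C^V,\ v\in V.$$ It is self-adjoint and negative semi-definite on $\ell^2_{m_j}(V)$; let $0=\lambda_1(\mathcal L_j)\ge\lambda_2(\mathcal L_j)\ge\cdots$ be its eigenvalues, counted with multiplicity. Assume that all the $\mathcal L_j$ are self-adjoint on one common Hilbert space $\ell^2_m(V)$, for some vertex weight $m:V\to(0,\infty)$ (for instance, $m_1=\dots=m_N=m$; in particular, unweighted graphs). Here $\ell^2_m(V)$ is $\mathbb C^V$ with scalar product $(f,g)_m=\sum_{v} m(v)f(v)\overline{g(v)}$. Let $P_0$ be the orthogonal projector of $\ell^2_m(V)$ onto the constant functions, and let $\|\cdot\|$ be the operator norm on $\ell^2_m(V)$. Assume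 that at least one of the graphs $G_j$ is connected. **Setting (switching process).** On a probability space let $(X_n,\tau_n)$ be a Markov renewal process with values in $\{1,\dots,N\}\times[0,\infty)$ such that, for all $n\ge0$, all $y$ and all real $t$, almost surely $$\mathbb P(X_{n+1}=y,\ \tau_{n+1}<t\mid X_0,\dots,X_n,\tau_1,\dots,\tau_n)=\pi(X_n,y)\,G_{X_n}(t),$$ where $\pi$ is an irreducible stochastic matrix and, for each $x$, $G_x$ is the distribution function of a law that either is concentrated at one point or has a continuous density on $(0,\infty)$ that is positive almost everywhere, and that has a finite mean $\bar\mu_x>0$. Let $T_n=\tau_1+\dots+\tau_n$, $N(t)=\max\{n:T_n\le t\}$, $Z(t)=X_{N(t)}$, let $\rho$ be the invariant distribution of $\pi$, and let $$\Theta_j=\frac{\rho_j\bar\mu_j}{\sum_{l=1}^N\rho_l\bar\mu_l},\qquad \alpha=-\sum_{j=1}^N\lambda_2(\mathcal L_j)\,\Theta_j.$$ The random propagator is $$S(t)=e^{(t-T_n)\mathcal L_{X_n}}\,e^{(T_n-T_{n-1})\mathcal L_{X_{n-1}}}\cdots e^{(T_1-T_0)\mathcal L_{X_0}}\qquad\text{for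 } T_n\le t<T_{n+1}.$$ **Statement.** For every $j$, almost surely $\frac1t\int_0^t\mathbf 1_{\{Z(s)=j\}}\,ds\to\Theta_j$ as $t\to\infty$. Moreover $\alpha>0$. Finally, almost surely, $S(t)\to P_0$ in norm as $t\to\infty$, exponentially fast with rate no lower than $\alpha$: for every $\beta<\alpha$ there is a (random) constant $C$ such that $\|S(t)-P_0\|\le C\,e^{-\beta t}$ for all $t\ge0$. -/

import Mathlib

open MeasureTheory ProbabilityTheory Filter Topology

open scoped ComplexConjugate

noncomputable section

namespace SwitchingGraphs

/-! ### Weighted graphs, weighted spaces of functions, discrete Laplacians -/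

/-- A positive weight function on a set of vertices. -/
structure VertexWeight (V : Type*) where
  /-- The weight of a vertex. -/
  wt : V → ℝ
  pos : ∀ v, 0 < wt v

/-- A weighted combinatorial graph on the vertex set `V`: a simple graph with positive vertex
weights and positive edge weights (extended by `0` to the pairs that are not edges). -/
structure WeightedGraph (V : Type*) where
  /-- The underlying simple graph. -/
  graph : SimpleGraph V
  /-- The vertex weight. -/
  m : VertexWeight V
  /-- The edge weight. -/
  μ : Sym2 V → ℝ
  μ_pos : ∀ e ∈ graph.edgeSet, 0 < μ e
  μ_zero : ∀ e ∉ graph.edgeSet, μ e = 0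

/-- The Hilbert space of all functions `V → ℂ` with the scalar product
`∑ v, m v * f v * conj (g v)`. -/
@[ext]
structure WeightedL2 {V : Type*} (m : VertexWeight V) where
  /-- The underlying function. -/
  val : V → ℂ

namespace WeightedL2

variable {V : Type*} (m : VertexWeight V)

/-- The elements are just functions. -/
def equivFun : WeightedL2 m ≃ (V → ℂ) where
  toFun := val
  invFun f := ⟨f⟩
  left_inv _ := rfl
  right_inv _ := rfl

instance : AddCommGroup (WeightedL2 m) := (equivFun m).addCommGroup

instance : Module ℂ (WeightedL2 m) := (equivFun m).module ℂ

variable {m} in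
@[simp] theorem val_add (f g : WeightedL2 m) (v : V) : (f + g).val v = f.val v + g.val v := rfl

variable {m} in
@[simp] theorem val_smul (r : ℂ) (f : WeightedL2 m) (v : V) :
    (r • f).val v = r * f.val v := rfl

/-- The linear version of the identification with functions. -/
def linearEquivFun : WeightedL2 m ≃ₗ[ℂ] (V → ℂ) := (equivFun m).linearEquiv ℂ

/-- The constant function with value one. -/
def one : WeightedL2 m := ⟨fun _ => 1⟩

variable [Fintype V]

instance : FiniteDimensional ℂ (WeightedL2 m) :=
  (linearEquivFun m).symm.finiteDimensional

/-- The weighted scalar product (conjugate-linear in the first argument, as in Mathlib). -/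
@[reducible]
def core : InnerProductSpace.Core ℂ (WeightedL2 m) where
  inner f g := ∑ v, (m.wt v : ℂ) * (conj (f.val v) * g.val v)
  conj_inner_symm f g := by
    simp only [map_sum, map_mul, Complex.conj_conj, Complex.conj_ofReal]
    exact Finset.sum_congr rfl fun v _ => by ring
  re_inner_nonneg f := by
    simp only [map_sum]
    refine Finset.sum_nonneg fun v _ => ?_
    rw [mul_comm (conj (f.val v)), Complex.mul_conj]
    have := mul_nonneg (m.pos v).le (Complex.normSq_nonneg (f.val v))
    simpa using this
  add_left f g h := by
    rw [← Finset.sum_add_distrib]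
    refine Finset.sum_congr rfl fun v _ => ?_
    rw [val_add, map_add]
    ring
  smul_left f g r := by
    rw [Finset.mul_sum]
    refine Finset.sum_congr rfl fun v _ => ?_
    rw [val_smul, map_mul]
    ring
  definite f hf := by
    have h1 : (∑ v, m.wt v * Complex.normSq (f.val v) : ℝ) = 0 := by
      have h2 : ((∑ v, m.wt v * Complex.normSq (f.val v) : ℝ) : ℂ) = 0 := by
        rw [← hf]
        push_cast
        refine Finset.sum_congr rfl fun v _ => ?_
        rw [mul_comm (conj (f.val v)), Complex.mul_conj]
      exact_mod_cast h2
    rw [Finset.sum_eq_zero_iff_of_nonneg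
      (fun v _ => mul_nonneg (m.pos v).le (Complex.normSq_nonneg _))] at h1
    ext v
    have h3 := h1 v (Finset.mem_univ v)
    rcases mul_eq_zero.1 h3 with h4 | h4
    · exact absurd h4 (m.pos v).ne'
    · exact Complex.normSq_eq_zero.1 h4

instance : NormedAddCommGroup (WeightedL2 m) := (core m).toNormedAddCommGroup

instance : InnerProductSpace ℂ (WeightedL2 m) := InnerProductSpace.ofCore (core m).toCore

instance : CompleteSpace (WeightedL2 m) := FiniteDimensional.complete ℂ _

variable {m} in
theorem inner_def (f g : WeightedL2 m) :
    inner ℂ f g = ∑ v, (m.wt v : ℂ) * (conj (f.val v) * g.val v) := rfl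

theorem finrank_eq : Module.finrank ℂ (WeightedL2 m) = Fintype.card V := by
  rw [(linearEquivFun m).finrank_eq, Module.finrank_fintype_fun_eq_card]

/-- The orthogonal projector `P₀` onto the space of constant functions. -/
def constProj : WeightedL2 m →L[ℂ] WeightedL2 m :=
  (Submodule.span ℂ {one m}).starProjection

end WeightedL2

namespace WeightedGraph

variable {V : Type*} [Fintype V]

open scoped Classical in
/-- The weighted discrete Laplacian
`(L f) v = (1 / m v) * ∑ (w adjacent to v), μ {v, w} * (f w - f v)`
of the weighted graph `G`, on the functions `V → ℂ`, which are
equipped with the scalar product given by some vertex weight `m'`. -/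
def laplacianOn (G : WeightedGraph V) (m' : VertexWeight V) :
    WeightedL2 m' →ₗ[ℂ] WeightedL2 m' where
  toFun f := ⟨fun v =>
    (1 / (G.m.wt v : ℂ)) *
      ∑ w with G.graph.Adj v w, (G.μ s(v, w) : ℂ) * (f.val w - f.val v)⟩
  map_add' f g := by
    ext v
    simp only [WeightedL2.val_add]
    rw [← mul_add, ← Finset.sum_add_distrib]
    congr 1
    refine Finset.sum_congr rfl fun w _ => ?_
    ring
  map_smul' r f := by
    ext v
    simp only [WeightedL2.val_smul, RingHom.id_apply]
    rw [mul_left_comm r, Finset.mul_sum (a := r)]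
    congr 1
    refine Finset.sum_congr rfl fun w _ => ?_
    ring

/-- The Laplacian of `G` is self-adjoint with respect to the vertex weight of `G`. -/
theorem laplacianOn_isSymmetric (G : WeightedGraph V) :
    (G.laplacianOn G.m).IsSymmetric := by
  classical
  have key : ∀ f g : WeightedL2 G.m, inner ℂ (G.laplacianOn G.m f) g =
      ∑ v, ∑ w, (G.μ s(v, w) : ℂ) * (conj (f.val w - f.val v) * g.val v) := by
    intro f g
    rw [WeightedL2.inner_def]
    refine Finset.sum_congr rfl fun v _ => ?_
    have hm : (G.m.wt v : ℂ) ≠ 0 := by exact_mod_cast (G.m.pos v).ne'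
    change _ * (conj ((1 / (G.m.wt v : ℂ)) * _) * _) = _
    rw [map_mul, map_div₀, map_one, Complex.conj_ofReal, map_sum, Finset.sum_filter,
      mul_assoc, ← mul_assoc, mul_one_div_cancel hm, one_mul, Finset.sum_mul]
    refine Finset.sum_congr rfl fun w _ => ?_
    split_ifs with h
    · rw [map_mul, Complex.conj_ofReal, mul_assoc]
    · rw [G.μ_zero s(v, w) (by simpa using h)]
      simp
  intro f g
  rw [← inner_conj_symm (f : WeightedL2 G.m) (G.laplacianOn G.m g), key, key]
  simp only [map_sum, map_mul, Complex.conj_conj, Complex.conj_ofReal, map_sub, mul_sub, sub_mul,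
    Finset.sum_sub_distrib]
  congr 1
  · rw [Finset.sum_comm]
    refine Finset.sum_congr rfl fun v _ => Finset.sum_congr rfl fun w _ => ?_
    rw [Sym2.eq_swap]
    ring
  · refine Finset.sum_congr rfl fun v _ => Finset.sum_congr rfl fun w _ => ?_
    ring

/-- The second largest eigenvalue, counted with multiplicity, of the Laplacian of `G` as a
self-adjoint operator on the weighted space belonging to `G`.
(Mathlib lists the eigenvalues in decreasing order, starting at index `0`.) -/
def lambda₂ [Nontrivial V] (G : WeightedGraph V) : ℝ :=
  G.laplacianOn_isSymmetric.eigenvalues (WeightedL2.finrank_eq G.m)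
    ⟨1, Fintype.one_lt_card⟩

end WeightedGraph

/-! ### The semi-Markov switching process -/

section Switching

variable {Ω : Type*} {N : ℕ}

/-- The regeneration times `T n = τ 1 + ⋯ + τ n` (the value `τ 0` is not used). -/
def regTime (τ : ℕ → Ω → ℝ) (n : ℕ) (ω : Ω) : ℝ := ∑ k ∈ Finset.range n, τ (k + 1) ω

/-- The counting process `max {n | T n ≤ t}`. -/
def counting (τ : ℕ → Ω → ℝ) (t : ℝ) (ω : Ω) : ℕ := sSup {n : ℕ | regTime τ n ω ≤ t}

/-- The semi-Markov process `Z t = X (counting t)`. -/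
def semiMarkov (X : ℕ → Ω → Fin N) (τ : ℕ → Ω → ℝ) (t : ℝ) (ω : Ω) : Fin N :=
  X (counting τ t ω) ω

/-- The history `σ(X 0, …, X n, τ 1, …, τ n)`. -/
@[reducible]
def history (X : ℕ → Ω → Fin N) (τ : ℕ → Ω → ℝ) (n : ℕ) : MeasurableSpace Ω :=
  (⨆ k ∈ Finset.range (n + 1), MeasurableSpace.comap (X k) ⊤) ⊔
    (⨆ k ∈ Finset.range n, MeasurableSpace.comap (τ (k + 1)) (borel ℝ))

/-- `(X n, τ n)` is a Markov renewal process with values in `Fin N × [0, ∞)` and transition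
function `q x y t = π x y * G x t`, where `G x t = ν x (-∞, t)`, that is
`P (X (n+1) = y, τ (n+1) < t | X 0, …, X n, τ 1, …, τ n) = π (X n) y * ν (X n) (-∞, t)`. -/
structure IsMarkovRenewal [MeasurableSpace Ω] (P : Measure Ω) (X : ℕ → Ω → Fin N)
    (τ : ℕ → Ω → ℝ) (π : Matrix (Fin N) (Fin N) ℝ) (ν : Fin N → Measure ℝ) : Prop where
  measurable_X : ∀ n, Measurable (X n)
  measurable_τ : ∀ n, Measurable (τ n)
  nonneg_τ : ∀ n ω, 0 ≤ τ n ω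
  transition : ∀ (n : ℕ) (y : Fin N) (t : ℝ),
    P[Set.indicator {ω | X (n + 1) ω = y ∧ τ (n + 1) ω < t} (fun _ => (1 : ℝ)) | history X τ n]
      =ᵐ[P] fun ω => π (X n ω) y * (ν (X n ω)).real (Set.Iio t)

/-- The standing assumptions on the transition matrix `π` of the embedded chain and on the laws
`ν x` of the time spent in the state `x` before the next jump. -/
structure IsAdmissible (π : Matrix (Fin N) (Fin N) ℝ) (ν : Fin N → Measure ℝ) : Prop where
  nonneg : ∀ x y, 0 ≤ π x y
  row_sum : ∀ x, ∑ y, π x y = 1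
  irreducible : ∀ x y, ∃ n : ℕ, 0 < (π ^ n) x y
  prob : ∀ x, IsProbabilityMeasure (ν x)
  /-- The time spent in `x` is constant or has a continuous, a.e. positive density on `(0, ∞)`. -/
  const_or_density : ∀ x, (∃ c : ℝ, ν x = Measure.dirac c) ∨
    ∃ g : ℝ → ℝ, ContinuousOn g (Set.Ioi 0) ∧
      (∀ᵐ t ∂(volume.restrict (Set.Ioi 0)), 0 < g t) ∧
      ν x = (volume.restrict (Set.Ioi 0)).withDensity fun t => ENNReal.ofReal (g t)
  integrable : ∀ x, Integrable (fun t : ℝ => t) (ν x)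
  mean_pos : ∀ x, 0 < ∫ t, t ∂(ν x)

/-- `ρ` is an invariant distribution of the Markov chain with transition matrix `π`. -/
structure IsInvariant (π : Matrix (Fin N) (Fin N) ℝ) (ρ : Fin N → ℝ) : Prop where
  nonneg : ∀ x, 0 ≤ ρ x
  sum_eq_one : ∑ x, ρ x = 1
  invariant : ∀ y, ∑ x, ρ x * π x y = ρ y

/-- `Θ x = ρ x * μ x / ∑ j, ρ j * μ j`, where `μ x` is the mean time spent in the state `x`. -/
def timeFraction (ρ : Fin N → ℝ) (ν : Fin N → Measure ℝ) (x : Fin N) : ℝ :=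
  (ρ x * ∫ t, t ∂(ν x)) / ∑ j, ρ j * ∫ t, t ∂(ν j)

variable {H : Type*} [NormedAddCommGroup H] [NormedSpace ℂ H]

/-- The product `e^{(T n - T (n-1)) A (X (n-1))} ⋯ e^{(T 1 - T 0) A (X 0)}`
(the most recent factor stands on the left). -/
def jumpProduct (A : Fin N → H →L[ℂ] H) (X : ℕ → Ω → Fin N) (τ : ℕ → Ω → ℝ) :
    ℕ → Ω → (H →L[ℂ] H)
  | 0, _ => 1
  | n + 1, ω =>
    NormedSpace.exp (((regTime τ (n + 1) ω - regTime τ n ω : ℝ) : ℂ) • A (X n ω)) *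
      jumpProduct A X τ n ω

/-- The random propagator: `S t = e^{(t - T n) A (X n)} ∏_{k < n} e^{(T (k+1) - T k) A (X k)}`
for `T n ≤ t < T (n+1)`. -/
def propagator (A : Fin N → H →L[ℂ] H) (X : ℕ → Ω → Fin N) (τ : ℕ → Ω → ℝ) (t : ℝ) (ω : Ω) :
    H →L[ℂ] H :=
  NormedSpace.exp (((t - regTime τ (counting τ t ω) ω : ℝ) : ℂ) • A (semiMarkov X τ t ω)) *
    jumpProduct A X τ (counting τ t ω) ω

end Switching

end SwitchingGraphs

end

/-! Every Laplacian annihilates the constants, and self-adjointness on the common space gives `P₀ L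
= L P₀ = 0`. Hence every exponential fixes `P₀` from both sides, `S(t) - P₀ = S(t)(1 - P₀)`, and all
factors act on the complement of the constants, where `e^{sL_j}` has norm at most `e^{λ₂(L_j)s}`.
The factors need not commute, since only norms are multiplied: `‖S(t) - P₀‖` is at most the
exponential of `∑ λ₂(L_j) · (time spent in j up to t)` (`norm_propagator_sub_le`,
`norm_exp_laplacianOn_le`). If the time fractions tend to `Θ_j`, the exponent divided by `t` tends
to `-α`. All `λ₂` are nonpositive, that of a connected graph is negative, and irreducibility makes
every `Θ_j` positive; so `α > 0`.

The time fractions come from a strong law for martingale differences. Applied to transition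
indicators, it makes every limit point of the visit frequencies an invariant distribution;
compactness of the simplex and uniqueness give convergence, with no aperiodicity needed
(`IsInvariant.tendsto_visits`). Holding times have only a first moment, so they are truncated at a
growing level and the truncation is removed by Borel–Cantelli (`ae_tendsto_centered_holding`).
Squeezing between consecutive jumps passes to continuous time (`tendsto_occupation_div`). -/

namespace SwitchingGraphs

/-! ### A law of large numbers for square integrable martingale differences -/

/-- Kronecker's lemma for the weights `1, 2, 3, …`. -/
theorem tendsto_average_zero_of_tendsto_sum_div {x : ℕ → ℝ} {s : ℝ}
    (h : Tendsto (fun n => ∑ k ∈ Finset.range n, x k / (k + 1)) atTop (𝓝 s)) :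
    Tendsto (fun n : ℕ => (n : ℝ)⁻¹ * ∑ k ∈ Finset.range n, x k) atTop (𝓝 0) := by
  set S : ℕ → ℝ := fun n => ∑ k ∈ Finset.range n, x k / (k + 1) with hS
  -- Summation by parts: after division by `n` this is `S n` minus its Cesàro mean, and both tend to
  -- `s`.
  have key : ∀ n : ℕ, ∑ k ∈ Finset.range n, x k = n * S n - ∑ k ∈ Finset.range n, S k := by
    intro n
    induction n with
    | zero => simp
    | succ n ih =>
      have h1 : S (n + 1) = S n + x n / (n + 1) := Finset.sum_range_succ _ _
      rw [Finset.sum_range_succ, Finset.sum_range_succ, ih, h1]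
      push_cast
      field_simp
      ring
  have h2 := h.sub h.cesaro
  rw [sub_self] at h2
  refine h2.congr' ?_
  filter_upwards [eventually_gt_atTop 0] with n hn
  rw [key n]
  field_simp

/-- The strong law of large numbers for martingale differences with summable
weighted second moments. -/
theorem ae_tendsto_average_zero_of_condExp_eq_zero {Ω : Type*} {m0 : MeasurableSpace Ω}
    {P : Measure Ω} [IsProbabilityMeasure P] {ℱ : Filtration ℕ m0} {D : ℕ → Ω → ℝ}
    (hmeas : ∀ n, StronglyMeasurable[ℱ (n + 1)] (D n)) (hL2 : ∀ n, MemLp (D n) 2 P)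
    (hzero : ∀ n, P[D n | ℱ n] =ᵐ[P] 0) (C : ℝ)
    (hC : ∀ K, ∑ k ∈ Finset.range K, (((k : ℝ) + 1) ^ 2)⁻¹ * ∫ ω, D k ω ^ 2 ∂P ≤ C) :
    ∀ᵐ ω ∂P, Tendsto (fun n : ℕ => (n : ℝ)⁻¹ * ∑ k ∈ Finset.range n, D k ω) atTop (𝓝 0) := by
  set d : ℕ → Ω → ℝ := fun k ω => D k ω / (k + 1) with hd
  -- The weighted sums `∑ D k / (k + 1)` form an `L²`-bounded martingale; it converges almost
  -- surely, and Kronecker's lemma finishes.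
  set M : ℕ → Ω → ℝ := fun n ω => ∑ k ∈ Finset.range n, d k ω with hM
  have hd_eq : ∀ k, d k = ((k : ℝ) + 1)⁻¹ • D k := fun k => by
    ext ω; simp [hd, div_eq_inv_mul]
  have hd2 : ∀ k, MemLp (d k) 2 P := fun k => by
    rw [hd_eq]; exact (hL2 k).const_smul _
  have hM_succ : ∀ n, M (n + 1) = M n + d n := fun n => by
    ext ω; simp [hM, Finset.sum_range_succ]
  have hM2 : ∀ n, MemLp (M n) 2 P := by
    intro n
    induction n with
    | zero => simp [hM]
    | succ n ih => rw [hM_succ]; exact ih.add (hd2 n)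
  have hMadp : ∀ n, StronglyMeasurable[ℱ n] (M n) := by
    intro n
    induction n with
    | zero => simpa [hM] using stronglyMeasurable_const
    | succ n ih =>
      rw [hM_succ, hd_eq]
      exact (ih.mono (ℱ.mono n.le_succ)).add ((hmeas n).const_smul _)
  have hdzero : ∀ n, P[d n | ℱ n] =ᵐ[P] 0 := fun n => by
    rw [hd_eq]
    refine (condExp_smul _ _ _).trans ?_
    filter_upwards [hzero n] with ω hω
    simp [hω]
  have hmart : Martingale M ℱ P := by
    refine martingale_of_condExp_sub_eq_zero_nat hMadp
      (fun n => (hM2 n).integrable one_le_two) fun n => ?_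
    rw [hM_succ, add_sub_cancel_left]
    exact hdzero n
  -- Increments are orthogonal to the past, so the second moments of `M` simply add up.
  have horth : ∀ n, ∫ ω, M n ω * d n ω ∂P = 0 := by
    intro n
    have hint : Integrable (M n * d n) P := (hM2 n).integrable_mul (hd2 n)
    have h1 := condExp_mul_of_stronglyMeasurable_left (hMadp n) hint
      ((hd2 n).integrable one_le_two)
    have h2 : ∫ ω, (P[M n * d n | ℱ n]) ω ∂P = ∫ ω, M n ω * d n ω ∂P :=
      integral_condExp (ℱ.le n)
    rw [← h2]
    refine integral_eq_zero_of_ae ?_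
    filter_upwards [h1, hdzero n] with ω h3 h4
    rw [h3, Pi.mul_apply, h4]
    simp
  have hsq : ∀ n, ∫ ω, M n ω ^ 2 ∂P =
      ∑ k ∈ Finset.range n, (((k : ℝ) + 1) ^ 2)⁻¹ * ∫ ω, D k ω ^ 2 ∂P := by
    intro n
    induction n with
    | zero => simp [hM]
    | succ n ih =>
      have h1 : ∀ ω, M (n + 1) ω ^ 2 = M n ω ^ 2 + 2 * (M n ω * d n ω) + d n ω ^ 2 := by
        intro ω
        rw [hM_succ, Pi.add_apply]
        ring
      have hint : Integrable (fun ω => M n ω * d n ω) P := (hM2 n).integrable_mul (hd2 n)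
      have hint' : Integrable (fun ω => M n ω ^ 2 + 2 * (M n ω * d n ω)) P :=
        (hM2 n).integrable_sq.add (hint.const_mul 2)
      simp_rw [h1]
      rw [integral_add hint' (hd2 n).integrable_sq,
        integral_add (hM2 n).integrable_sq (hint.const_mul 2), integral_const_mul, horth, ih,
        Finset.sum_range_succ, ← integral_const_mul]
      simp only [mul_zero, add_zero, add_right_inj]
      refine integral_congr_ae (Eventually.of_forall fun ω => ?_)
      simp only [hd]
      field_simp
  -- The `L¹` bound follows from the `L²` bound through `|x| ≤ 1 + x ^ 2`.
  have hbdd : ∀ n, eLpNorm (M n) 1 P ≤ ((1 + C).toNNReal : ENNReal) := by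
    intro n
    have hint := (hM2 n).integrable one_le_two
    rw [eLpNorm_one_eq_lintegral_enorm, ← ofReal_integral_norm_eq_lintegral_enorm hint]
    refine ENNReal.ofReal_le_ofReal ?_
    calc ∫ ω, ‖M n ω‖ ∂P ≤ ∫ ω, (1 + M n ω ^ 2) ∂P := by
          refine integral_mono hint.norm ((integrable_const _).add (hM2 n).integrable_sq)
            fun ω => ?_
          simp only [Real.norm_eq_abs]
          nlinarith [sq_nonneg (|M n ω| - 1), sq_abs (M n ω), sq_nonneg (M n ω)]
      _ ≤ 1 + C := by
          rw [integral_add (integrable_const _) (hM2 n).integrable_sq, hsq]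
          simpa using hC n
  filter_upwards [hmart.submartingale.exists_ae_tendsto_of_bdd hbdd] with ω ⟨s, hs⟩
  exact tendsto_average_zero_of_tendsto_sum_div hs

end SwitchingGraphs

namespace SwitchingGraphs

/-! ### The law of large numbers along a Markov renewal process -/

section MarkovRenewal

variable {Ω : Type*} {N : ℕ}

theorem history_mono (X : ℕ → Ω → Fin N) (τ : ℕ → Ω → ℝ) : Monotone (history X τ) := by
  intro a b hab
  refine sup_le_sup ?_ ?_
  · exact biSup_mono fun k hk => Finset.range_mono (by omega) hk
  · exact biSup_mono fun k hk => Finset.range_mono hab hk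

theorem measurable_history_state (X : ℕ → Ω → Fin N) (τ : ℕ → Ω → ℝ) (n : ℕ) :
    Measurable[history X τ n] (X n) := by
  refine Measurable.mono (comap_measurable (m := ⊤) (X n)) ?_ le_top
  exact le_sup_of_le_left
    (le_iSup₂_of_le n (Finset.mem_range.2 n.lt_succ_self) le_rfl)

theorem measurable_history_holding (X : ℕ → Ω → Fin N) (τ : ℕ → Ω → ℝ) (n : ℕ) :
    Measurable[history X τ (n + 1)] (τ (n + 1)) := by
  refine Measurable.mono (comap_measurable (m := borel ℝ) (τ (n + 1))) ?_
    (BorelSpace.measurable_eq (α := ℝ)).le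
  exact le_sup_of_le_right
    (le_iSup₂_of_le n (Finset.mem_range.2 n.lt_succ_self) le_rfl)

theorem measurableSet_history_state (X : ℕ → Ω → Fin N) (τ : ℕ → Ω → ℝ) (n : ℕ) (i : Fin N) :
    MeasurableSet[history X τ n] {ω | X n ω = i} :=
  measurable_history_state X τ n (measurableSet_singleton i)

theorem integrable_of_bounded {E : Type*} [MeasurableSpace E] {Q : Measure E} [IsFiniteMeasure Q]
    {f : E → ℝ} (hf : Measurable f) {K : ℝ} (hK : ∀ x, |f x| ≤ K) : Integrable f Q :=
  Integrable.of_bound hf.aestronglyMeasurable K (Eventually.of_forall hK)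

theorem measurable_uncurry_step [MeasurableSpace Ω] {Y : Ω → Fin N} {T : Ω → ℝ}
    {φ : Fin N → ℝ → ℝ} (hφ : ∀ j, Measurable (φ j)) (hY : Measurable Y)
    (hT : Measurable T) : Measurable fun ω => φ (Y ω) (T ω) := by
  have : Measurable (Function.uncurry φ) := measurable_from_prod_countable_right hφ
  exact this.comp (hY.prodMk hT)

variable [m0 : MeasurableSpace Ω] {P : Measure Ω}
  {X : ℕ → Ω → Fin N} {τ : ℕ → Ω → ℝ} {π : Matrix (Fin N) (Fin N) ℝ} {ν : Fin N → Measure ℝ}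

theorem IsMarkovRenewal.history_le (hZ : IsMarkovRenewal P X τ π ν) (n : ℕ) :
    history X τ n ≤ m0 := by
  refine sup_le (iSup₂_le fun k _ => (hZ.measurable_X k).comap_le)
    (iSup₂_le fun k _ => ?_)
  rw [← BorelSpace.measurable_eq (α := ℝ)]
  exact (hZ.measurable_τ (k + 1)).comap_le

/-- The filtration generated by a Markov renewal process. -/
def historyFiltration (hZ : IsMarkovRenewal P X τ π ν) : Filtration ℕ m0 where
  seq := history X τ
  mono' := history_mono X τ
  le' := hZ.history_le

/-- Given the past and the present state `i`, the next state and the holding time are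
independent, with laws `π i` and `ν i`. -/
theorem IsMarkovRenewal.map_restrict_eq [IsProbabilityMeasure P]
    (hZ : IsMarkovRenewal P X τ π ν) (hπν : IsAdmissible π ν) (n : ℕ) {s : Set Ω}
    (hs : MeasurableSet[history X τ n] s) (i j : Fin N) :
    (P.restrict ((s ∩ {ω | X n ω = i}) ∩ {ω | X (n + 1) ω = j})).map (τ (n + 1)) =
      (ENNReal.ofReal (π i j) * P (s ∩ {ω | X n ω = i})) • ν i := by
  have := hπν.prob i
  set s' := s ∩ {ω | X n ω = i} with hs'
  have hs'm : MeasurableSet[history X τ n] s' := hs.inter (measurableSet_history_state X τ n i)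
  have hs'm0 : MeasurableSet s' := hZ.history_le n _ hs'm
  have hj : MeasurableSet {ω | X (n + 1) ω = j} :=
    hZ.measurable_X (n + 1) (measurableSet_singleton j)
  -- The transition law is known only on half-lines `(-∞, t)`; these form a generating π-system,
  -- which suffices.
  refine Measure.ext_of_generateFrom_of_iUnion (Set.range Set.Iio) (fun k : ℕ => Set.Iio (k : ℝ))
    ?_ isPiSystem_Iio ?_ (fun k => ⟨_, rfl⟩) (fun k => measure_ne_top _ _) ?_
  · rw [BorelSpace.measurable_eq (α := ℝ)]
    exact borel_eq_generateFrom_Iio ℝ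
  · ext x
    simpa using exists_nat_gt x
  · rintro _ ⟨t, rfl⟩
    have hτ : MeasurableSet {ω | τ (n + 1) ω < t} := hZ.measurable_τ (n + 1) measurableSet_Iio
    rw [Measure.map_apply (hZ.measurable_τ _) measurableSet_Iio,
      Measure.restrict_apply (hZ.measurable_τ _ measurableSet_Iio),
      Measure.smul_apply, smul_eq_mul]
    have hE : MeasurableSet {ω | X (n + 1) ω = j ∧ τ (n + 1) ω < t} := hj.inter hτ
    have h1 : ∫ ω in s', Set.indicator {ω | X (n + 1) ω = j ∧ τ (n + 1) ω < t}
        (fun _ => (1 : ℝ)) ω ∂P = ∫ ω in s', π (X n ω) j * (ν (X n ω)).real (Set.Iio t) ∂P := by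
      rw [← setIntegral_condExp (hZ.history_le n) ((integrable_const _).indicator hE) hs'm]
      exact integral_congr_ae (ae_restrict_of_ae (hZ.transition n j t))
    rw [integral_indicator hE, Measure.restrict_restrict hE, setIntegral_const,
      setIntegral_congr_fun (g := fun _ => π i j * (ν i).real (Set.Iio t)) hs'm0
        (fun ω hω => by rw [show X n ω = i from hω.2]), setIntegral_const] at h1
    have h2 : τ (n + 1) ⁻¹' Set.Iio t ∩ (s' ∩ {ω | X (n + 1) ω = j}) =
        {ω | X (n + 1) ω = j ∧ τ (n + 1) ω < t} ∩ s' := by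
      ext ω
      simp only [Set.mem_inter_iff, Set.mem_preimage, Set.mem_Iio, Set.mem_ofPred_eq]
      tauto
    rw [h2, ← ENNReal.toReal_eq_toReal_iff' (measure_ne_top _ _)
      (ENNReal.mul_ne_top (ENNReal.mul_ne_top ENNReal.ofReal_ne_top (measure_ne_top _ _))
        (measure_ne_top _ _)), ENNReal.toReal_mul, ENNReal.toReal_mul,
      ENNReal.toReal_ofReal (hπν.nonneg i j)]
    simp only [smul_eq_mul, mul_one, Measure.real] at h1
    rw [h1]
    ring

/-- The mean of `φ y t` when `y` has law `π i` and `t` has law `ν i`, independently. -/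
noncomputable def stepMean (π : Matrix (Fin N) (Fin N) ℝ) (ν : Fin N → Measure ℝ) (i : Fin N)
    (φ : Fin N → ℝ → ℝ) : ℝ :=
  ∑ j, π i j * ∫ t, φ j t ∂(ν i)

/-- Splitting by the next state reduces this to the conditional law of the holding time. It
identifies the conditional expectation of a step function on `{X n = i}` as the constant `stepMean`.
-/
theorem IsMarkovRenewal.setIntegral_step [IsProbabilityMeasure P]
    (hZ : IsMarkovRenewal P X τ π ν) (hπν : IsAdmissible π ν) (n : ℕ) {s : Set Ω}
    (hs : MeasurableSet[history X τ n] s) (i : Fin N) {φ : Fin N → ℝ → ℝ}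
    (hφ : ∀ j, Measurable (φ j)) {K : ℝ} (hK : ∀ j t, |φ j t| ≤ K) :
    ∫ ω in s ∩ {ω | X n ω = i}, φ (X (n + 1) ω) (τ (n + 1) ω) ∂P =
      P.real (s ∩ {ω | X n ω = i}) * stepMean π ν i φ := by
  have hj : ∀ j, MeasurableSet {ω | X (n + 1) ω = j} := fun j =>
    hZ.measurable_X (n + 1) (measurableSet_singleton j)
  have h1 : ∀ ω, φ (X (n + 1) ω) (τ (n + 1) ω) =
      ∑ j, Set.indicator {ω | X (n + 1) ω = j} (fun ω => φ j (τ (n + 1) ω)) ω := by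
    intro ω
    rw [Finset.sum_eq_single (X (n + 1) ω)]
    · simp
    · intro j _ hne
      simp [hne.symm]
    · simp
  simp_rw [h1]
  have hint : ∀ j, Integrable (Set.indicator {ω | X (n + 1) ω = j} fun ω => φ j (τ (n + 1) ω))
      (P.restrict (s ∩ {ω | X n ω = i})) := fun j =>
    Integrable.indicator (integrable_of_bounded
      (by have := (hφ j).comp (hZ.measurable_τ (n + 1)); exact this) fun ω => hK j _) (hj j)
  rw [integral_finsetSum _ fun j _ => hint j, stepMean, Finset.mul_sum]
  refine Finset.sum_congr rfl fun j _ => ?_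
  rw [integral_indicator (hj j), Measure.restrict_restrict (hj j), Set.inter_comm {ω | _ = j},
    ← integral_map (f := φ j) (hZ.measurable_τ (n + 1)).aemeasurable
      (hφ j).aestronglyMeasurable, hZ.map_restrict_eq hπν n hs i j, integral_smul_measure,
    ENNReal.toReal_mul, ENNReal.toReal_ofReal (hπν.nonneg i j), smul_eq_mul, Measure.real]
  ring

/-- A variance is at most the second moment, here for the product law of next state and holding
time. -/
theorem stepMean_sub_sq (hπν : IsAdmissible π ν) (i : Fin N) {φ : Fin N → ℝ → ℝ}
    (hφ : ∀ j, Measurable (φ j)) {K : ℝ} (hK : ∀ j t, |φ j t| ≤ K) :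
    stepMean π ν i (fun j t => (φ j t - stepMean π ν i φ) ^ 2) ≤
      stepMean π ν i (fun j t => φ j t ^ 2) := by
  have := hπν.prob i
  set c := stepMean π ν i φ with hc
  have h1 : ∀ j, ∫ t, (φ j t - c) ^ 2 ∂(ν i) =
      ∫ t, φ j t ^ 2 ∂(ν i) - 2 * c * ∫ t, φ j t ∂(ν i) + c ^ 2 := by
    intro j
    have hi1 : Integrable (φ j) (ν i) := integrable_of_bounded (hφ j) (hK j)
    have hi2 : Integrable (fun t => φ j t ^ 2) (ν i) :=
      integrable_of_bounded ((hφ j).pow_const 2) (K := K ^ 2) fun t => by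
        rw [abs_pow]
        exact pow_le_pow_left₀ (abs_nonneg _) (hK j t) 2
    have h2 : ∀ t, (φ j t - c) ^ 2 = φ j t ^ 2 - 2 * c * φ j t + c ^ 2 := fun t => by ring
    have hi3 : Integrable (fun t => φ j t ^ 2 - 2 * c * φ j t) (ν i) :=
      hi2.sub (hi1.const_mul _)
    simp_rw [h2]
    rw [integral_add hi3 (integrable_const _), integral_sub hi2 (hi1.const_mul _),
      integral_const_mul]
    simp
  have h2 : stepMean π ν i (fun j t => (φ j t - c) ^ 2) =
      stepMean π ν i (fun j t => φ j t ^ 2) - 2 * c * c + c ^ 2 := by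
    have h3 : c ^ 2 = ∑ j, π i j * c ^ 2 := by rw [← Finset.sum_mul, hπν.row_sum, one_mul]
    conv_rhs => rw [h3, show 2 * c * c = ∑ j, π i j * (2 * c * ∫ t, φ j t ∂(ν i)) from by
      conv_lhs => rw [show 2 * c * c = 2 * c * stepMean π ν i φ from by rw [← hc]]
      rw [stepMean, Finset.mul_sum]
      exact Finset.sum_congr rfl fun j _ => by ring]
    simp only [stepMean]
    rw [← Finset.sum_sub_distrib, ← Finset.sum_add_distrib]
    refine Finset.sum_congr rfl fun j _ => ?_
    rw [h1]
    ring
  rw [h2]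
  nlinarith [sq_nonneg c]

theorem stepMean_nonneg (hπν : IsAdmissible π ν) (i : Fin N) {φ : Fin N → ℝ → ℝ}
    (h : ∀ j t, 0 ≤ φ j t) : 0 ≤ stepMean π ν i φ :=
  Finset.sum_nonneg fun j _ => mul_nonneg (hπν.nonneg i j) (integral_nonneg (h j))

theorem stepMean_of_state (hπν : IsAdmissible π ν) (i : Fin N) (a : Fin N → ℝ) :
    stepMean π ν i (fun j _ => a j) = ∑ j, π i j * a j := by
  have := hπν.prob i
  simp [stepMean]

theorem stepMean_of_time (hπν : IsAdmissible π ν) (i : Fin N) (f : ℝ → ℝ) :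
    stepMean π ν i (fun _ t => f t) = ∫ t, f t ∂(ν i) := by
  simp [stepMean, ← Finset.sum_mul, hπν.row_sum]

/-- The law of large numbers for functions of the steps that start in the state `i`. -/
theorem IsMarkovRenewal.ae_tendsto_average [IsProbabilityMeasure P]
    (hZ : IsMarkovRenewal P X τ π ν) (hπν : IsAdmissible π ν) (i : Fin N)
    {φ : ℕ → Fin N → ℝ → ℝ} (hφ : ∀ n j, Measurable (φ n j)) {K : ℕ → ℝ}
    (hK : ∀ n j t, |φ n j t| ≤ K n) (C : ℝ)
    (hC : ∀ m, ∑ k ∈ Finset.range m,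
      (((k : ℝ) + 1) ^ 2)⁻¹ * stepMean π ν i (fun j t => φ k j t ^ 2) ≤ C) :
    ∀ᵐ ω ∂P, Tendsto (fun n : ℕ => (n : ℝ)⁻¹ * ∑ k ∈ Finset.range n,
      if X k ω = i then φ k (X (k + 1) ω) (τ (k + 1) ω) - stepMean π ν i (φ k) else 0)
      atTop (𝓝 0) := by
  -- A martingale difference: the centred step function, switched off unless the step starts in `i`.
  -- Letting `φ` depend on `k` allows a growing truncation level.
  set D : ℕ → Ω → ℝ := fun k => Set.indicator {ω | X k ω = i}
    fun ω => φ k (X (k + 1) ω) (τ (k + 1) ω) - stepMean π ν i (φ k) with hD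
  have hi : ∀ n, MeasurableSet {ω | X n ω = i} := fun n =>
    hZ.measurable_X n (measurableSet_singleton i)
  have hmeas : ∀ n, StronglyMeasurable[history X τ (n + 1)] (D n) := by
    intro n
    refine StronglyMeasurable.indicator ?_
      (history_mono X τ n.le_succ _ (measurableSet_history_state X τ n i))
    exact ((@measurable_uncurry_step _ _ (history X τ (n + 1)) _ _ _ (hφ n) (measurable_history_state X τ (n + 1))
      (measurable_history_holding X τ n)).sub_const _).stronglyMeasurable
  have hbound : ∀ n ω, |φ n (X (n + 1) ω) (τ (n + 1) ω) - stepMean π ν i (φ n)| ≤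
      K n + |stepMean π ν i (φ n)| := fun n ω =>
    (abs_sub _ _).trans (by gcongr; exact hK n _ _)
  have hDbound : ∀ n ω, |D n ω| ≤ K n + |stepMean π ν i (φ n)| := by
    intro n ω
    by_cases h : X n ω = i
    · simpa [hD, h] using hbound n ω
    · simpa [hD, h] using (abs_nonneg _).trans (hbound n ω)
  have hD0 : ∀ n, Measurable (D n) := fun n =>
    ((hmeas n).mono (hZ.history_le _)).measurable
  have hstep : ∀ n, Measurable fun ω => φ n (X (n + 1) ω) (τ (n + 1) ω) := fun n =>
    measurable_uncurry_step (hφ n) (hZ.measurable_X _) (hZ.measurable_τ _)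
  have hzero : ∀ n, P[D n | history X τ n] =ᵐ[P] 0 := by
    intro n
    refine (ae_eq_condExp_of_forall_setIntegral_eq (hZ.history_le n)
      (integrable_of_bounded (hD0 n) (hDbound n)) (fun s _ _ => integrableOn_zero)
      (fun s hs _ => ?_) aestronglyMeasurable_zero).symm
    rw [hD, setIntegral_indicator (hi n), integral_sub (integrable_of_bounded (hstep n)
      fun ω => hK n _ _) (integrable_const _), hZ.setIntegral_step hπν n hs i (hφ n) (hK n)]
    simp
  refine (ae_tendsto_average_zero_of_condExp_eq_zero (ℱ := historyFiltration hZ) hmeas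
    (fun n => MemLp.of_bound (hD0 n).aestronglyMeasurable _
      (Eventually.of_forall (hDbound n))) hzero C fun m => ?_).mono fun ω hω => ?_
  · refine (Finset.sum_le_sum fun k _ => ?_).trans (hC m)
    refine mul_le_mul_of_nonneg_left ?_ (by positivity)
    have h1 : ∀ ω, D k ω ^ 2 = Set.indicator {ω | X k ω = i} (fun ω =>
        (φ k (X (k + 1) ω) (τ (k + 1) ω) - stepMean π ν i (φ k)) ^ 2) ω := by
      intro ω
      by_cases h : X k ω = i <;> simp [hD, h]
    simp_rw [h1]
    have h2 := hZ.setIntegral_step hπν k MeasurableSet.univ i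
      (φ := fun j t => (φ k j t - stepMean π ν i (φ k)) ^ 2)
      (fun j => ((hφ k j).sub_const _).pow_const 2) (K := (K k + |stepMean π ν i (φ k)|) ^ 2)
      (fun j t => by
        rw [abs_pow]
        refine pow_le_pow_left₀ (abs_nonneg _) ((abs_sub _ _).trans ?_) 2
        gcongr
        exact hK k _ _)
    rw [Set.univ_inter] at h2
    rw [integral_indicator (hi k), h2]
    refine (mul_le_of_le_one_left (stepMean_nonneg hπν i fun j t => sq_nonneg _)
      measureReal_le_one).trans (stepMean_sub_sq hπν i (hφ k) (hK k))
  · simpa only [hD, Set.indicator_apply, Set.mem_ofPred_eq] using hω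

end MarkovRenewal

end SwitchingGraphs

namespace SwitchingGraphs

/-! ### Invariant distributions and limits of empirical averages -/

section Invariant

variable {N : ℕ} {π : Matrix (Fin N) (Fin N) ℝ} {ν : Fin N → Measure ℝ} {ρ : Fin N → ℝ}

open scoped Matrix

theorem vecMul_pow_of_vecMul_eq {d : Fin N → ℝ} (hd : d ᵥ* π = d) (n : ℕ) :
    d ᵥ* (π ^ n) = d := by
  induction n with
  | zero => simp
  | succ n ih => rw [pow_succ, ← Matrix.vecMul_vecMul, ih, hd]

theorem IsAdmissible.pow_nonneg (hπν : IsAdmissible π ν) (n : ℕ) (x y : Fin N) :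
    0 ≤ (π ^ n) x y := by
  induction n generalizing x y with
  | zero => rw [pow_zero, Matrix.one_apply]; split_ifs <;> norm_num
  | succ n ih =>
    rw [pow_succ, Matrix.mul_apply]
    exact Finset.sum_nonneg fun z _ => mul_nonneg (ih x z) (hπν.nonneg z y)

/-- A nonnegative invariant measure of an irreducible chain that vanishes at some state
is zero. -/
theorem IsAdmissible.eq_zero_of_vecMul_eq (hπν : IsAdmissible π ν) {d : Fin N → ℝ}
    (h0 : ∀ x, 0 ≤ d x) (hd : d ᵥ* π = d) {i : Fin N} (hi : d i = 0) : d = 0 := by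
  ext x
  -- Invariance under `π ^ n` writes `d i = 0` as a sum of nonnegative terms, one of which is `d x`
  -- times a positive number.
  obtain ⟨n, hn⟩ := hπν.irreducible x i
  have h1 : ∑ z, d z * (π ^ n) z i = 0 := by
    have := congrFun (vecMul_pow_of_vecMul_eq hd n) i
    rwa [hi] at this
  have h2 := (Finset.sum_eq_zero_iff_of_nonneg fun z _ =>
    mul_nonneg (h0 z) (hπν.pow_nonneg n z i)).1 h1 x (Finset.mem_univ x)
  exact (mul_eq_zero.1 h2).resolve_right hn.ne'

theorem IsInvariant.vecMul_eq (hρ : IsInvariant π ρ) : ρ ᵥ* π = ρ :=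
  funext hρ.invariant

theorem IsInvariant.pos (hρ : IsInvariant π ρ) (hπν : IsAdmissible π ν) (x : Fin N) :
    0 < ρ x := by
  refine (hρ.nonneg x).lt_of_ne fun h => ?_
  have := hρ.sum_eq_one
  simp [hπν.eq_zero_of_vecMul_eq hρ.nonneg hρ.vecMul_eq h.symm] at this

/-- The invariant distribution of an irreducible chain is unique. -/
theorem IsInvariant.unique (hρ : IsInvariant π ρ) (hπν : IsAdmissible π ν) {q : Fin N → ℝ}
    (hq : IsInvariant π q) : q = ρ := by
  have hne : Nonempty (Fin N) := by
    by_contra h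
    rw [not_nonempty_iff] at h
    simpa using hρ.sum_eq_one
  -- Subtracting the minimal ratio times `ρ` leaves a nonnegative invariant measure that vanishes at
  -- the minimiser, hence zero.
  obtain ⟨i, hi⟩ := Finite.exists_min fun x => q x / ρ x
  set c := q i / ρ i with hc
  have h0 : ∀ x, 0 ≤ (q - c • ρ) x := fun x => by
    have := (le_div_iff₀ (hρ.pos hπν x)).1 (hi x)
    simpa using this
  have h1 : (q - c • ρ) ᵥ* π = q - c • ρ := by
    rw [Matrix.sub_vecMul, Matrix.smul_vecMul, hq.vecMul_eq, hρ.vecMul_eq]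
  have h2 : (q - c • ρ) i = 0 := by
    have := (hρ.pos hπν i).ne'
    simp [hc, this]
  have h3 : q = c • ρ := sub_eq_zero.1 (hπν.eq_zero_of_vecMul_eq h0 h1 h2)
  have h4 := hq.sum_eq_one
  rw [h3] at h4
  simp only [Pi.smul_apply, smul_eq_mul, ← Finset.mul_sum, hρ.sum_eq_one, mul_one] at h4
  rw [h3, h4, one_smul]

theorem sum_ite_eq_state (x : ℕ → Fin N) (k : ℕ) (f : Fin N → ℝ) :
    ∑ i, (if x k = i then f i else 0) = f (x k) := by simp

/-- If the empirical transition frequencies of a sequence of states are compatible with `π`, then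
the fractions of visits converge to the invariant distribution. -/
theorem IsInvariant.tendsto_visits (hρ : IsInvariant π ρ) (hπν : IsAdmissible π ν)
    {x : ℕ → Fin N}
    (h : ∀ i y, Tendsto (fun n : ℕ => (n : ℝ)⁻¹ * ∑ k ∈ Finset.range n,
      if x k = i then (if x (k + 1) = y then (1 : ℝ) else 0) - π i y else 0) atTop (𝓝 0)) :
    Tendsto (fun (n : ℕ) i => (n : ℝ)⁻¹ * ∑ k ∈ Finset.range n, if x k = i then (1 : ℝ) else 0)
      atTop (𝓝 ρ) := by
  set p : ℕ → Fin N → ℝ :=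
    fun n i => (n : ℝ)⁻¹ * ∑ k ∈ Finset.range n, if x k = i then (1 : ℝ) else 0 with hp
  -- Visit frequencies are asymptotically invariant: shifting time by one changes the visit count of
  -- `y` only by two boundary terms.
  have hdiff : ∀ y, Tendsto (fun n => p n y - ∑ i, p n i * π i y) atTop (𝓝 0) := by
    intro y
    have h1 : Tendsto (fun n : ℕ => (n : ℝ)⁻¹ * (if x n = y then (1 : ℝ) else 0)) atTop (𝓝 0) := by
      refine squeeze_zero (fun n => ?_) (fun n => ?_) tendsto_inv_atTop_nhds_zero_nat
      · split_ifs <;> simp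
      · split_ifs <;> simp
    have h2 : Tendsto (fun n : ℕ => (n : ℝ)⁻¹ * (if x 0 = y then (1 : ℝ) else 0)) atTop (𝓝 0) := by
      simpa using tendsto_inv_atTop_nhds_zero_nat.mul_const (if x 0 = y then (1 : ℝ) else 0)
    have h3 := ((tendsto_finsetSum Finset.univ fun i _ => h i y).sub h1).add h2
    simp only [Finset.sum_const_zero, sub_zero, add_zero] at h3
    refine h3.congr fun n => ?_
    have h4 : ∑ k ∈ Finset.range n, (if x (k + 1) = y then (1 : ℝ) else 0) =
        ∑ k ∈ Finset.range n, (if x k = y then (1 : ℝ) else 0) +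
          (if x n = y then (1 : ℝ) else 0) - (if x 0 = y then (1 : ℝ) else 0) := by
      rw [← Finset.sum_range_succ, Finset.sum_range_succ', add_sub_cancel_right]
    have h5 : ∑ i, p n i * π i y = (n : ℝ)⁻¹ * ∑ k ∈ Finset.range n, π (x k) y := by
      simp only [hp, mul_assoc, Finset.sum_mul]
      rw [← Finset.mul_sum, Finset.sum_comm]
      congr 1
      refine Finset.sum_congr rfl fun k _ => ?_
      simp
    have h6 : ∑ i, (n : ℝ)⁻¹ * ∑ k ∈ Finset.range n,
        (if x k = i then (if x (k + 1) = y then (1 : ℝ) else 0) - π i y else 0) =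
        (n : ℝ)⁻¹ * (∑ k ∈ Finset.range n, (if x (k + 1) = y then (1 : ℝ) else 0) -
          ∑ k ∈ Finset.range n, π (x k) y) := by
      rw [← Finset.mul_sum, Finset.sum_comm, ← Finset.sum_sub_distrib]
      congr 1
      exact Finset.sum_congr rfl fun k _ =>
        sum_ite_eq_state x k fun i => (if x (k + 1) = y then (1 : ℝ) else 0) - π i y
    rw [h6, h5, h4]
    simp only [hp]
    ring
  -- The case `n = 0` is excluded because `p 0` is zero, the inverse of `0` being `0`.
  have hsimplex : ∀ n, 0 < n → p n ∈ stdSimplex ℝ (Fin N) := by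
    intro n hn
    refine ⟨fun i => mul_nonneg (by positivity)
      (Finset.sum_nonneg fun k _ => by split_ifs <;> norm_num), ?_⟩
    have hn' : (n : ℝ) ≠ 0 := by exact_mod_cast hn.ne'
    simp only [hp]
    rw [← Finset.mul_sum, Finset.sum_comm]
    simp [hn']
  refine (isCompact_stdSimplex ℝ (Fin N)).tendsto_nhds_of_unique_mapClusterPt
    ((eventually_gt_atTop 0).mono hsimplex) fun q hq hcl => ?_
  obtain ⟨φ, hφ, hlim⟩ := hcl.tendsto_subseq
  refine hρ.unique hπν ⟨hq.1, hq.2, fun y => ?_⟩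
  have hcoord : ∀ i, Tendsto (fun k => p (φ k) i) atTop (𝓝 (q i)) := fun i =>
    (tendsto_pi_nhds.1 hlim) i
  have h1 := (hcoord y).sub
    (tendsto_finsetSum Finset.univ fun i _ => (hcoord i).mul_const (π i y))
  have h2 := (hdiff y).comp hφ.tendsto_atTop
  have := tendsto_nhds_unique h1 h2
  linarith

end Invariant

/-! ### Strong laws for visits and holding times -/

section LawOfLargeNumbers

variable {Ω : Type*} {N : ℕ} [m0 : MeasurableSpace Ω] {P : Measure Ω}
  {X : ℕ → Ω → Fin N} {τ : ℕ → Ω → ℝ} {π : Matrix (Fin N) (Fin N) ℝ} {ν : Fin N → Measure ℝ}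
  {ρ : Fin N → ℝ}

theorem sum_range_inv_sq_le (m : ℕ) : ∑ k ∈ Finset.range m, (((k : ℝ) + 1) ^ 2)⁻¹ ≤
    ∑' k : ℕ, (((k : ℝ) + 1) ^ 2)⁻¹ := by
  have h : Summable fun k : ℕ => (((k : ℝ) + 1) ^ 2)⁻¹ := by
    have := (summable_nat_add_iff 1).2 (Real.summable_nat_pow_inv.2 (show 1 < 2 by norm_num))
    simpa using this
  exact h.sum_le_tsum _ fun k _ => by positivity

/-- The fractions of visits of the embedded chain converge to the invariant distribution. -/
theorem IsMarkovRenewal.ae_tendsto_visits [IsProbabilityMeasure P]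
    (hZ : IsMarkovRenewal P X τ π ν) (hπν : IsAdmissible π ν) (hρ : IsInvariant π ρ) :
    ∀ᵐ ω ∂P, Tendsto (fun (n : ℕ) i => (n : ℝ)⁻¹ * ∑ k ∈ Finset.range n,
      if X k ω = i then (1 : ℝ) else 0) atTop (𝓝 ρ) := by
  have h : ∀ i y, ∀ᵐ ω ∂P, Tendsto (fun n : ℕ => (n : ℝ)⁻¹ * ∑ k ∈ Finset.range n,
      if X k ω = i then (if X (k + 1) ω = y then (1 : ℝ) else 0) - π i y else 0)
      atTop (𝓝 0) := by
    intro i y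
    have h1 := hZ.ae_tendsto_average hπν i
      (φ := fun _ j _ => if j = y then (1 : ℝ) else 0) (fun _ _ => measurable_const)
      (K := fun _ => (1 : ℝ))
      (fun _ j _ => by split_ifs <;> norm_num) (∑' k : ℕ, (((k : ℝ) + 1) ^ 2)⁻¹) (fun m => by
        refine (Finset.sum_le_sum fun k _ => ?_).trans (sum_range_inv_sq_le m)
        rw [stepMean_of_state hπν i fun j => (if j = y then (1 : ℝ) else 0) ^ 2]
        refine mul_le_of_le_one_right (by positivity) ?_
        refine (Finset.sum_le_sum fun j _ =>
          mul_le_of_le_one_right (hπν.nonneg i j) ?_).trans (hπν.row_sum i).le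
        split_ifs <;> norm_num)
    rw [stepMean_of_state hπν i fun j => if j = y then (1 : ℝ) else 0] at h1
    simpa using h1
  have h' : ∀ᵐ ω ∂P, ∀ i y, Tendsto (fun n : ℕ => (n : ℝ)⁻¹ * ∑ k ∈ Finset.range n,
      if X k ω = i then (if X (k + 1) ω = y then (1 : ℝ) else 0) - π i y else 0)
      atTop (𝓝 0) := ae_all_iff.2 fun i => ae_all_iff.2 fun y => h i y
  filter_upwards [h'] with ω hω
  exact hρ.tendsto_visits hπν hω

/-- Summing over the next state leaves `P (X n = i)` times `ν i B`. The bound does not depend on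
`n`, as Borel–Cantelli for the long holding times requires. -/
theorem IsMarkovRenewal.measure_holding_le [IsProbabilityMeasure P]
    (hZ : IsMarkovRenewal P X τ π ν) (hπν : IsAdmissible π ν) (n : ℕ) (i : Fin N) {B : Set ℝ}
    (hB : MeasurableSet B) : P {ω | X n ω = i ∧ τ (n + 1) ω ∈ B} ≤ ν i B := by
  have hsub : {ω | X n ω = i ∧ τ (n + 1) ω ∈ B} ⊆
      ⋃ j, (τ (n + 1) ⁻¹' B ∩ ((Set.univ ∩ {ω | X n ω = i}) ∩ {ω | X (n + 1) ω = j})) := by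
    rintro ω ⟨h1, h2⟩
    exact Set.mem_iUnion.2 ⟨X (n + 1) ω, h2, ⟨trivial, h1⟩, rfl⟩
  refine (measure_mono hsub).trans ((measure_iUnion_fintype_le _ _).trans ?_)
  calc ∑ j, P (τ (n + 1) ⁻¹' B ∩ ((Set.univ ∩ {ω | X n ω = i}) ∩ {ω | X (n + 1) ω = j}))
      ≤ ∑ j, ENNReal.ofReal (π i j) * ν i B := by
        refine Finset.sum_le_sum fun j _ => ?_
        have h1 := congrArg (fun Q : Measure ℝ => Q B)
          (hZ.map_restrict_eq hπν n MeasurableSet.univ i j)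
        simp only [Measure.map_apply (hZ.measurable_τ _) hB,
          Measure.restrict_apply (hZ.measurable_τ _ hB), Measure.smul_apply, smul_eq_mul] at h1
        rw [h1]
        gcongr
        exact mul_le_of_le_one_right' prob_le_one
    _ = ν i B := by
        rw [← Finset.sum_mul, ← ENNReal.ofReal_sum_of_nonneg fun j _ => hπν.nonneg i j,
          hπν.row_sum, ENNReal.ofReal_one, one_mul]

/-- A point mass sits at its mean, which is positive; a law with a density lives on `(0, ∞)`. -/
theorem IsAdmissible.ae_nonneg (hπν : IsAdmissible π ν) (i : Fin N) : ∀ᵐ t ∂(ν i), 0 ≤ t := by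
  rcases hπν.const_or_density i with ⟨c, hc⟩ | ⟨g, -, -, hg⟩
  · have := hπν.mean_pos i
    rw [hc, integral_dirac] at this
    rw [hc, ae_dirac_iff measurableSet_Ici]
    exact this.le
  · rw [hg]
    refine withDensity_absolutelyContinuous _ _ ?_
    filter_upwards [ae_restrict_mem measurableSet_Ioi] with t ht
    exact le_of_lt ht

theorem measurable_truncation_abs (A : ℝ) : Measurable (truncation (fun t : ℝ => |t|) A) :=
  (measurable_id.indicator measurableSet_Ioc).comp measurable_norm

theorem tendsto_truncated_mean (hπν : IsAdmissible π ν) (i : Fin N) :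
    Tendsto (fun k : ℕ => ∫ t, truncation (fun t : ℝ => |t|) (k + 1) t ∂(ν i)) atTop
      (𝓝 (∫ t, t ∂(ν i))) := by
  have h1 : ∫ t, |t| ∂(ν i) = ∫ t, t ∂(ν i) :=
    integral_congr_ae ((hπν.ae_nonneg i).mono fun t ht => abs_of_nonneg ht)
  rw [← h1]
  exact (tendsto_integral_truncation (hπν.integrable i).abs).comp
    (tendsto_atTop_add_const_right _ _ tendsto_natCast_atTop_atTop)

/-- The strong law of large numbers for the holding times in one state. -/
theorem IsMarkovRenewal.ae_tendsto_centered_holding [IsProbabilityMeasure P]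
    (hZ : IsMarkovRenewal P X τ π ν) (hπν : IsAdmissible π ν) (i : Fin N) :
    ∀ᵐ ω ∂P, Tendsto (fun n : ℕ => (n : ℝ)⁻¹ * ∑ k ∈ Finset.range n,
      if X k ω = i then τ (k + 1) ω - ∫ t, t ∂(ν i) else 0) atTop (𝓝 0) := by
  have hprob := hπν.prob i
  -- The truncation estimates want a function nonnegative everywhere; `|t|` agrees with `t` almost
  -- everywhere for `ν i` and at all holding times.
  set f : ℝ → ℝ := fun t => |t| with hf
  have hint : Integrable f (ν i) := (hπν.integrable i).abs
  have hnonneg : 0 ≤ f := fun t => abs_nonneg t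
  have hLLN := hZ.ae_tendsto_average hπν i
    (φ := fun k _ t => truncation f (k + 1) t) (fun k _ => measurable_truncation_abs _)
    (K := fun k => |(k : ℝ) + 1|) (fun k _ t => abs_truncation_le_bound f _ t)
    (2 * ∫ t, f t ∂(ν i)) (fun m => by
      -- The real line with the law `ν i` serves as probability space. Dropping the term of index
      -- `0` and shifting gives the weights `(k + 1) ^ 2`.
      have h1 := @sum_variance_truncation_le ℝ ⟨ν i⟩ hprob f hint hnonneg (m + 1)
      rw [Finset.sum_range_succ'] at h1
      refine le_trans (le_of_eq ?_) ((le_add_of_nonneg_right ?_).trans h1)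
      · refine Finset.sum_congr rfl fun k _ => ?_
        rw [stepMean_of_time hπν i fun t => truncation f (k + 1) t ^ 2]
        push_cast
        rfl
      · simp)
  -- A finite mean makes the tails `ν i {|t| > k}` summable, so almost surely only finitely many
  -- holding times in `i` are affected by truncation.
  have hBC : ∀ᵐ ω ∂P, ∀ᶠ k : ℕ in atTop,
      ω ∉ {ω | X k ω = i ∧ τ (k + 1) ω ∈ {t | f t ∈ Set.Ioi ((k : ℝ))}} := by
    refine ae_eventually_notMem (ne_top_of_le_ne_top
      (@tsum_prob_mem_Ioi_lt_top ℝ ⟨ν i⟩ hprob f hint hnonneg).ne ?_)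
    exact ENNReal.tsum_le_tsum fun k => hZ.measure_holding_le hπν k i
      (measurableSet_lt measurable_const measurable_norm)
  filter_upwards [hLLN, hBC] with ω h1 h2
  have h3 : Tendsto (fun k : ℕ => if X k ω = i then
      τ (k + 1) ω - truncation f (k + 1) (τ (k + 1) ω) else 0) atTop (𝓝 0) := by
    refine tendsto_const_nhds.congr' ?_
    filter_upwards [h2] with k hk
    split_ifs with hX
    · have h4 : ¬ (k : ℝ) < |τ (k + 1) ω| := fun h => hk ⟨hX, h⟩
      rw [truncation_eq_self (by rw [abs_of_nonneg (hnonneg _)]; simp only [hf]; linarith)]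
      simp [hf, abs_of_nonneg (hZ.nonneg_τ (k + 1) ω)]
    · rfl
  have h4 : Tendsto (fun k : ℕ => if X k ω = i then
      ∫ t, truncation f (k + 1) t ∂(ν i) - ∫ t, t ∂(ν i) else 0) atTop (𝓝 0) := by
    have h5 := (tendsto_truncated_mean hπν i).sub_const (∫ t, t ∂(ν i))
    rw [sub_self] at h5
    refine squeeze_zero_norm (fun k => ?_) (by simpa using h5.norm)
    split_ifs
    · exact le_rfl
    · simp
  -- The centred truncation, the truncation error and the error of the truncated mean add up to `τ
  -- (k + 1) - ∫ t ∂(ν i)`.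
  have h6 := (h1.add h3.cesaro).add h4.cesaro
  simp only [add_zero] at h6
  refine h6.congr fun n => ?_
  rw [← mul_add, ← mul_add, ← Finset.sum_add_distrib, ← Finset.sum_add_distrib]
  congr 1
  refine Finset.sum_congr rfl fun k _ => ?_
  rw [stepMean_of_time hπν i fun t => truncation f (k + 1) t]
  split_ifs <;> ring

/-- The time spent in the state `i` during the first `n` steps grows like `n ρ i μ i`. -/
theorem IsMarkovRenewal.ae_tendsto_holding [IsProbabilityMeasure P]
    (hZ : IsMarkovRenewal P X τ π ν) (hπν : IsAdmissible π ν) (hρ : IsInvariant π ρ) :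
    ∀ᵐ ω ∂P, ∀ i, Tendsto (fun n : ℕ => (n : ℝ)⁻¹ * ∑ k ∈ Finset.range n,
      if X k ω = i then τ (k + 1) ω else 0) atTop (𝓝 (ρ i * ∫ t, t ∂(ν i))) := by
  filter_upwards [hZ.ae_tendsto_visits hπν hρ,
    ae_all_iff.2 fun i => hZ.ae_tendsto_centered_holding hπν i] with ω h1 h2 i
  have h3 := (h2 i).add ((tendsto_pi_nhds.1 h1 i).mul_const (∫ t, t ∂(ν i)))
  rw [zero_add] at h3
  refine h3.congr fun n => ?_
  rw [mul_assoc, ← mul_add, Finset.sum_mul, ← Finset.sum_add_distrib]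
  congr 1
  refine Finset.sum_congr rfl fun k _ => ?_
  split_ifs <;> ring

end LawOfLargeNumbers

end SwitchingGraphs

namespace SwitchingGraphs

/-! ### Occupation times in continuous time -/

section Occupation

variable {Ω : Type*} {N : ℕ} {X : ℕ → Ω → Fin N} {τ : ℕ → Ω → ℝ} {ω : Ω}

/-- The time spent in the state `i` during the first `n` steps. -/
noncomputable def holdingSum (X : ℕ → Ω → Fin N) (τ : ℕ → Ω → ℝ) (i : Fin N) (n : ℕ) (ω : Ω) :
    ℝ :=
  ∑ k ∈ Finset.range n, if X k ω = i then τ (k + 1) ω else 0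

/-- The time spent in the state `i` up to time `t`. -/
noncomputable def occupation (X : ℕ → Ω → Fin N) (τ : ℕ → Ω → ℝ) (i : Fin N) (t : ℝ) (ω : Ω) :
    ℝ :=
  holdingSum X τ i (counting τ t ω) ω +
    if semiMarkov X τ t ω = i then t - regTime τ (counting τ t ω) ω else 0

theorem regTime_zero (τ : ℕ → Ω → ℝ) (ω : Ω) : regTime τ 0 ω = 0 := by simp [regTime]

theorem regTime_succ (τ : ℕ → Ω → ℝ) (n : ℕ) (ω : Ω) :
    regTime τ (n + 1) ω = regTime τ n ω + τ (n + 1) ω := Finset.sum_range_succ _ _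

theorem regTime_mono (hτ : ∀ n, 0 ≤ τ n ω) : Monotone fun n => regTime τ n ω :=
  monotone_nat_of_le_succ fun n => by
    simpa only [regTime_succ, le_add_iff_nonneg_right] using hτ (n + 1)

theorem holdingSum_succ (X : ℕ → Ω → Fin N) (τ : ℕ → Ω → ℝ) (i : Fin N) (n : ℕ) (ω : Ω) :
    holdingSum X τ i (n + 1) ω =
      holdingSum X τ i n ω + if X n ω = i then τ (n + 1) ω else 0 := Finset.sum_range_succ _ _

theorem holdingSum_nonneg (hτ : ∀ n, 0 ≤ τ n ω) (i : Fin N) (n : ℕ) :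
    0 ≤ holdingSum X τ i n ω :=
  Finset.sum_nonneg fun k _ => by split_ifs <;> simp [hτ]

theorem sum_holdingSum (n : ℕ) : ∑ i, holdingSum X τ i n ω = regTime τ n ω := by
  simp only [holdingSum, regTime]
  rw [Finset.sum_comm]
  simp

theorem counting_eq (hτ : ∀ n, 0 ≤ τ n ω) {n : ℕ} {t : ℝ} (h1 : regTime τ n ω ≤ t)
    (h2 : t < regTime τ (n + 1) ω) : counting τ t ω = n := by
  have : {k : ℕ | regTime τ k ω ≤ t} = Set.Iic n := by
    ext k
    simp only [Set.mem_ofPred_eq, Set.mem_Iic]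
    refine ⟨fun h => ?_, fun h => (regTime_mono hτ h).trans h1⟩
    by_contra hk
    have := regTime_mono hτ (show n + 1 ≤ k by omega)
    simp only at this
    linarith
  rw [counting, this, csSup_Iic]

/-- Divergence of the jump times keeps the set in `counting` bounded, so that `sSup` is a true
maximum and not its default value `0`. The first `n` with `t < T (n + 1)` is that maximum, even if
some holding times vanish. -/
theorem counting_spec (hτ : ∀ n, 0 ≤ τ n ω)
    (hT : Tendsto (fun n => regTime τ n ω) atTop atTop) {t : ℝ} (ht : 0 ≤ t) :
    regTime τ (counting τ t ω) ω ≤ t ∧ t < regTime τ (counting τ t ω + 1) ω := by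
  classical
  have hex : ∃ n, t < regTime τ (n + 1) ω :=
    (((tendsto_add_atTop_iff_nat 1).2 hT).eventually_gt_atTop t).exists
  have h2 := Nat.find_spec hex
  have h1 : regTime τ (Nat.find hex) ω ≤ t := by
    rcases Nat.eq_zero_or_pos (Nat.find hex) with h | h
    · rw [h, regTime_zero]
      exact ht
    · have := Nat.find_min hex (m := Nat.find hex - 1) (by omega)
      rw [Nat.sub_add_cancel h] at this
      exact not_lt.1 this
  rw [counting_eq hτ h1 h2]
  exact ⟨h1, h2⟩

theorem tendsto_counting (hτ : ∀ n, 0 ≤ τ n ω)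
    (hT : Tendsto (fun n => regTime τ n ω) atTop atTop) :
    Tendsto (fun t => counting τ t ω) atTop atTop := by
  refine tendsto_atTop.2 fun n => ?_
  filter_upwards [eventually_ge_atTop (regTime τ n ω), eventually_ge_atTop 0] with t ht ht0
  by_contra h
  have h1 := (counting_spec hτ hT ht0).2
  have h2 := regTime_mono hτ (show counting τ t ω + 1 ≤ n by omega)
  simp only at h2
  linarith

/-- Between two jumps the process stays in one state. -/
theorem integral_indicator_step (hτ : ∀ n, 0 ≤ τ n ω) (i : Fin N) {n : ℕ} {b : ℝ}
    (h1 : regTime τ n ω ≤ b) (h2 : b ≤ regTime τ (n + 1) ω) :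
    IntervalIntegrable (Set.indicator {s : ℝ | semiMarkov X τ s ω = i} fun _ => (1 : ℝ)) volume
      (regTime τ n ω) b ∧
    ∫ s in regTime τ n ω..b, Set.indicator {s : ℝ | semiMarkov X τ s ω = i} (fun _ => (1 : ℝ)) s =
      if X n ω = i then b - regTime τ n ω else 0 := by
  -- The right endpoint is discarded as a null set, since the process may already have jumped there.
  have hae : ∀ᵐ s ∂volume, s ∈ Set.uIoc (regTime τ n ω) b → (if X n ω = i then (1 : ℝ) else 0) =
      Set.indicator {s : ℝ | semiMarkov X τ s ω = i} (fun _ => (1 : ℝ)) s := by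
    filter_upwards [compl_mem_ae_iff.2 (measure_singleton (μ := volume) b)] with s hs hs'
    rw [Set.uIoc_of_le h1] at hs'
    have hsb : s < b := hs'.2.lt_of_ne hs
    have : semiMarkov X τ s ω = X n ω := by
      rw [semiMarkov, counting_eq hτ hs'.1.le (hsb.trans_le h2)]
    simp [Set.indicator_apply, this]
  constructor
  · refine (intervalIntegrable_const (c := if X n ω = i then (1 : ℝ) else 0)).congr_ae ?_
    exact (ae_restrict_iff' measurableSet_uIoc).2 hae
  · rw [← intervalIntegral.integral_congr_ae hae, intervalIntegral.integral_const]
    split_ifs <;> simp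

/-- Induction over the completed steps, plus the current incomplete one; integrability is carried
along because additivity over adjacent intervals needs it. -/
theorem integral_indicator_eq_occupation (hτ : ∀ n, 0 ≤ τ n ω)
    (hT : Tendsto (fun n => regTime τ n ω) atTop atTop) (i : Fin N) {t : ℝ} (ht : 0 ≤ t) :
    ∫ s in (0 : ℝ)..t, Set.indicator {s : ℝ | semiMarkov X τ s ω = i} (fun _ => (1 : ℝ)) s =
      occupation X τ i t ω := by
  set F : ℝ → ℝ := Set.indicator {s : ℝ | semiMarkov X τ s ω = i} fun _ => (1 : ℝ) with hF
  have key : ∀ n, IntervalIntegrable F volume 0 (regTime τ n ω) ∧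
      ∫ s in (0 : ℝ)..regTime τ n ω, F s = holdingSum X τ i n ω := by
    intro n
    induction n with
    | zero => simp [regTime_zero, holdingSum]
    | succ n ih =>
      obtain ⟨h1, h2⟩ := integral_indicator_step (X := X) hτ i
        (b := regTime τ (n + 1) ω) (regTime_mono hτ n.le_succ) le_rfl
      refine ⟨ih.1.trans h1, ?_⟩
      rw [← intervalIntegral.integral_add_adjacent_intervals ih.1 h1, ih.2, h2, holdingSum_succ,
        regTime_succ, add_sub_cancel_left]
  obtain ⟨ha, hb⟩ := counting_spec hτ hT ht
  obtain ⟨h1, h2⟩ := integral_indicator_step (X := X) hτ i ha hb.le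
  rw [← intervalIntegral.integral_add_adjacent_intervals (key _).1 h1, (key _).2, h2]
  rfl

theorem tendsto_regTime_div {c : Fin N → ℝ}
    (hc : ∀ i, Tendsto (fun n : ℕ => (n : ℝ)⁻¹ * holdingSum X τ i n ω) atTop (𝓝 (c i))) :
    Tendsto (fun n : ℕ => (n : ℝ)⁻¹ * regTime τ n ω) atTop (𝓝 (∑ i, c i)) := by
  refine (tendsto_finsetSum Finset.univ fun i _ => hc i).congr fun n => ?_
  rw [← Finset.mul_sum, sum_holdingSum]

theorem tendsto_regTime_atTop {M : ℝ} (hM : 0 < M)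
    (h : Tendsto (fun n : ℕ => (n : ℝ)⁻¹ * regTime τ n ω) atTop (𝓝 M)) :
    Tendsto (fun n => regTime τ n ω) atTop atTop := by
  refine (tendsto_natCast_atTop_atTop.atTop_mul_pos hM h).congr' ?_
  filter_upwards [eventually_gt_atTop 0] with n hn
  field_simp

theorem occupation_nonneg (hτ : ∀ n, 0 ≤ τ n ω)
    (hT : Tendsto (fun n => regTime τ n ω) atTop atTop) (i : Fin N) {t : ℝ} (ht : 0 ≤ t) :
    0 ≤ occupation X τ i t ω := by
  have h1 := (counting_spec hτ hT ht).1
  refine add_nonneg (holdingSum_nonneg hτ i _) ?_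
  split_ifs <;> linarith

/-- The fraction of time spent in a state converges if the average holding times do. -/
theorem tendsto_occupation_div (hτ : ∀ n, 0 ≤ τ n ω) {c : Fin N → ℝ} (hM : 0 < ∑ i, c i)
    (hc : ∀ i, Tendsto (fun n : ℕ => (n : ℝ)⁻¹ * holdingSum X τ i n ω) atTop (𝓝 (c i)))
    (i : Fin N) :
    Tendsto (fun t : ℝ => t⁻¹ * occupation X τ i t ω) atTop (𝓝 (c i / ∑ j, c j)) := by
  have hR := tendsto_regTime_div hc
  have hT := tendsto_regTime_atTop hM hR
  have hN := tendsto_counting hτ hT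
  have hratio : Tendsto (fun n : ℕ => ((n : ℝ) + 1) * (n : ℝ)⁻¹) atTop (𝓝 1) := by
    have := (tendsto_const_nhds (x := (1 : ℝ))).add
      (tendsto_inv_atTop_nhds_zero_nat (𝕜 := ℝ))
    rw [add_zero] at this
    refine this.congr' ?_
    filter_upwards [eventually_gt_atTop 0] with n hn
    field_simp
  -- With `n` the number of jumps up to `t` and `H` the holding sums, `H n / T (n + 1) ≤ occupation
  -- / t ≤ H (n + 1) / T n`; `hratio` absorbs the shifts.
  have hlow : Tendsto (fun n : ℕ => holdingSum X τ i n ω / regTime τ (n + 1) ω) atTop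
      (𝓝 (c i / ∑ j, c j)) := by
    have h1 := ((tendsto_add_atTop_iff_nat 1).2 hR).mul hratio
    rw [mul_one] at h1
    refine ((hc i).div h1 hM.ne').congr' ?_
    filter_upwards [eventually_gt_atTop 0] with n hn
    rw [Pi.div_apply]
    push_cast
    field_simp
  have hupp : Tendsto (fun n : ℕ => holdingSum X τ i (n + 1) ω / regTime τ n ω) atTop
      (𝓝 (c i / ∑ j, c j)) := by
    have h1 := ((tendsto_add_atTop_iff_nat 1).2 (hc i)).mul hratio
    rw [mul_one] at h1
    refine (h1.div hR hM.ne').congr' ?_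
    filter_upwards [eventually_gt_atTop 0] with n hn
    rw [Pi.div_apply]
    push_cast
    field_simp
  refine tendsto_of_tendsto_of_tendsto_of_le_of_le' (hlow.comp hN) (hupp.comp hN) ?_ ?_
  · filter_upwards [eventually_gt_atTop 0] with t ht
    obtain ⟨h1, h2⟩ := counting_spec hτ hT ht.le
    have h4 : holdingSum X τ i (counting τ t ω) ω ≤ occupation X τ i t ω := by
      rw [occupation, le_add_iff_nonneg_right]
      split_ifs <;> linarith
    rw [Function.comp_apply, ← div_eq_inv_mul]
    have h5 := occupation_nonneg (X := X) hτ hT i ht.le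
    gcongr
  -- The upper bound divides by the last jump time, which is positive only for large `t`.
  · filter_upwards [eventually_gt_atTop 0, hN.eventually (hT.eventually_gt_atTop 0)]
      with t ht hpos
    obtain ⟨h1, h2⟩ := counting_spec hτ hT ht.le
    have h3 := holdingSum_nonneg (X := X) hτ i (counting τ t ω + 1)
    have h4 : occupation X τ i t ω ≤ holdingSum X τ i (counting τ t ω + 1) ω := by
      rw [occupation, holdingSum_succ, semiMarkov]
      rw [regTime_succ] at h2
      split_ifs <;> linarith
    rw [Function.comp_apply, ← div_eq_inv_mul]
    gcongr

/-- Regrouping by state turns the exponent accumulated step by step into occupation times. -/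
theorem sum_mul_occupation (r : Fin N → ℝ) (t : ℝ) :
    ∑ i, r i * occupation X τ i t ω =
      ∑ k ∈ Finset.range (counting τ t ω), r (X k ω) * τ (k + 1) ω +
        r (semiMarkov X τ t ω) * (t - regTime τ (counting τ t ω) ω) := by
  simp only [occupation, holdingSum, mul_add, Finset.sum_add_distrib, Finset.mul_sum]
  rw [Finset.sum_comm]
  simp

end Occupation

/-! ### Products of exponentials -/

section Products

variable {Ω : Type*} {N : ℕ} {X : ℕ → Ω → Fin N} {τ : ℕ → Ω → ℝ} {ω : Ω}
  {H : Type*} [NormedAddCommGroup H] [NormedSpace ℂ H]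

/-- Every term of the exponential series except the zeroth kills `p`. -/
theorem exp_mul_of_mul_eq_zero [CompleteSpace H] {a p : H →L[ℂ] H} (h : a * p = 0) :
    NormedSpace.exp a * p = p := by
  have h1 := (NormedSpace.exp_series_hasSum_exp' (𝕂 := ℂ) a).mul_right p
  have h2 : HasSum (fun n : ℕ => ((n.factorial : ℂ)⁻¹ • a ^ n) * p) p := by
    convert hasSum_single (f := fun n : ℕ => ((n.factorial : ℂ)⁻¹ • a ^ n) * p) 0 ?_ using 1
    · simp
    · intro n hn
      obtain ⟨k, rfl⟩ := Nat.exists_eq_succ_of_ne_zero hn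
      rw [smul_mul_assoc, pow_succ, mul_assoc, h, mul_zero, smul_zero]
  exact h1.unique h2

theorem mul_exp_of_mul_eq_zero [CompleteSpace H] {a p : H →L[ℂ] H} (h : p * a = 0) :
    p * NormedSpace.exp a = p := by
  have h1 := (NormedSpace.exp_series_hasSum_exp' (𝕂 := ℂ) a).mul_left p
  have h2 : HasSum (fun n : ℕ => p * ((n.factorial : ℂ)⁻¹ • a ^ n)) p := by
    convert hasSum_single (f := fun n : ℕ => p * ((n.factorial : ℂ)⁻¹ • a ^ n)) 0 ?_ using 1
    · simp
    · intro n hn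
      obtain ⟨k, rfl⟩ := Nat.exists_eq_succ_of_ne_zero hn
      rw [mul_smul_comm, pow_succ', ← mul_assoc, h, zero_mul, smul_zero]
  exact h1.unique h2

theorem exp_apply_of_apply_eq_smul [CompleteSpace H] {a : H →L[ℂ] H} {v : H} {c : ℂ}
    (h : a v = c • v) : NormedSpace.exp a v = Complex.exp c • v := by
  have h1 := (NormedSpace.exp_series_hasSum_exp' (𝕂 := ℂ) a).mapL
    (ContinuousLinearMap.apply ℂ H v)
  have h2 := (NormedSpace.exp_series_hasSum_exp' (𝕂 := ℂ) c).smul_const v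
  rw [← Complex.exp_eq_exp_ℂ] at h2
  refine h1.unique ?_
  have h3 : ∀ n : ℕ, (a ^ n) v = c ^ n • v := by
    intro n
    induction n with
    | zero => simp
    | succ n ih =>
      rw [pow_succ', mul_apply_eq_comp, ih, map_smul, h, smul_smul, pow_succ]
  simpa [h3, smul_smul] using h2

variable {A : Fin N → H →L[ℂ] H} {p : H →L[ℂ] H}

theorem jumpProduct_mul_proj [CompleteSpace H] (hA : ∀ j, A j * p = 0) (n : ℕ) :
    jumpProduct A X τ n ω * p = p := by
  induction n with
  | zero => simp [jumpProduct]
  | succ n ih =>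
    rw [jumpProduct, mul_assoc, ih]
    exact exp_mul_of_mul_eq_zero (by rw [smul_mul_assoc, hA, smul_zero])

theorem proj_mul_jumpProduct [CompleteSpace H] (hA : ∀ j, p * A j = 0) (n : ℕ) :
    p * jumpProduct A X τ n ω = p := by
  induction n with
  | zero => simp [jumpProduct]
  | succ n ih =>
    rw [jumpProduct, ← mul_assoc, mul_exp_of_mul_eq_zero (by rw [mul_smul_comm, hA, smul_zero]),
      ih]

/-- The product preserves the kernel of `p`, so `1 - p` may be reinserted before the next factor;
decay is available only for `e^{sA}(1 - p)`. -/
theorem one_sub_mul_jumpProduct_mul [CompleteSpace H] (hp : p * p = p) (hA : ∀ j, p * A j = 0)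
    (n : ℕ) :
    (1 - p) * (jumpProduct A X τ n ω * (1 - p)) = jumpProduct A X τ n ω * (1 - p) := by
  rw [sub_mul, one_mul, ← mul_assoc, proj_mul_jumpProduct hA, mul_sub p, hp, mul_one, sub_self,
    sub_zero]

/-- One more factor costs no multiplicative constant. Used both for completed steps and for the last
incomplete one. -/
theorem norm_exp_mul_jumpProduct_le [CompleteSpace H] (hp : p * p = p) (hA : ∀ j, p * A j = 0)
    {r : Fin N → ℝ}
    (hr : ∀ j (s : ℝ), 0 ≤ s → ‖NormedSpace.exp ((s : ℂ) • A j) * (1 - p)‖ ≤ Real.exp (r j * s))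
    {n : ℕ} {b : ℝ} (hb : ‖jumpProduct A X τ n ω * (1 - p)‖ ≤ Real.exp b) (j : Fin N) {s : ℝ}
    (hs : 0 ≤ s) :
    ‖NormedSpace.exp ((s : ℂ) • A j) * jumpProduct A X τ n ω * (1 - p)‖ ≤
      Real.exp (b + r j * s) := by
  rw [mul_assoc, ← one_sub_mul_jumpProduct_mul hp hA, ← mul_assoc, add_comm, Real.exp_add]
  exact (norm_mul_le _ _).trans (mul_le_mul (hr j s hs) hb (norm_nonneg _) (Real.exp_nonneg _))

theorem norm_jumpProduct_le [CompleteSpace H] (hp : p * p = p) (hA : ∀ j, p * A j = 0)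
    {r : Fin N → ℝ}
    (hr : ∀ j (s : ℝ), 0 ≤ s → ‖NormedSpace.exp ((s : ℂ) • A j) * (1 - p)‖ ≤ Real.exp (r j * s))
    (hτ : ∀ n, 0 ≤ τ n ω) (n : ℕ) :
    ‖jumpProduct A X τ n ω * (1 - p)‖ ≤
      Real.exp (∑ k ∈ Finset.range n, r (X k ω) * τ (k + 1) ω) := by
  induction n with
  -- The hypothesis at time `0` says `‖1 - p‖ ≤ 1`.
  | zero => simpa [jumpProduct] using hr (X 0 ω) 0 le_rfl
  | succ n ih =>
    rw [Finset.sum_range_succ, jumpProduct, regTime_succ, add_sub_cancel_left]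
    exact norm_exp_mul_jumpProduct_le hp hA hr ih _ (hτ _)

/-- The distance of the propagator from the common fixed projector is controlled by the
occupation times. -/
theorem norm_propagator_sub_le [CompleteSpace H] (hp : p * p = p) (hA : ∀ j, p * A j = 0)
    (hA' : ∀ j, A j * p = 0) {r : Fin N → ℝ}
    (hr : ∀ j (s : ℝ), 0 ≤ s → ‖NormedSpace.exp ((s : ℂ) • A j) * (1 - p)‖ ≤ Real.exp (r j * s))
    (hτ : ∀ n, 0 ≤ τ n ω) {t : ℝ} (ht : regTime τ (counting τ t ω) ω ≤ t) :
    ‖propagator A X τ t ω - p‖ ≤ Real.exp (∑ i, r i * occupation X τ i t ω) := by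
  have h1 : propagator A X τ t ω - p = propagator A X τ t ω * (1 - p) := by
    have h2 : propagator A X τ t ω * p = p := by
      rw [propagator, mul_assoc, jumpProduct_mul_proj hA',
        exp_mul_of_mul_eq_zero (by rw [smul_mul_assoc, hA', smul_zero])]
    rw [mul_sub, mul_one, h2]
  rw [h1, sum_mul_occupation]
  exact norm_exp_mul_jumpProduct_le hp hA hr (norm_jumpProduct_le hp hA hr hτ _) _
    (sub_nonneg.2 ht)

end Products

end SwitchingGraphs

namespace SwitchingGraphs

/-! ### The spectral gap of the Laplacians -/

section Spectral

variable {E : Type*} [NormedAddCommGroup E] [InnerProductSpace ℂ E] [FiniteDimensional ℂ E]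

/-- On the orthogonal complement of all the eigenvectors with eigenvalues above `r`, the semigroup
generated by a symmetric operator decays at least like `exp (r * t)`. -/
theorem norm_exp_smul_apply_le [CompleteSpace E] {T : E →ₗ[ℂ] E} (hT : T.IsSymmetric) {r : ℝ}
    {f : E}
    (hf : ∀ (μ : ℝ) (v : E), r < μ → T v = (μ : ℂ) • v → inner ℂ v f = 0) {t : ℝ} (ht : 0 ≤ t) :
    ‖NormedSpace.exp ((t : ℂ) • T.toContinuousLinearMap) f‖ ≤ Real.exp (r * t) * ‖f‖ := by
  set b := hT.eigenvectorBasis rfl with hb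
  set μ := hT.eigenvalues rfl with hμ
  have hTb : ∀ i, T (b i) = (μ i : ℂ) • b i := hT.apply_eigenvectorBasis rfl
  set g := NormedSpace.exp ((t : ℂ) • T.toContinuousLinearMap) f with hg
  have hexp : ∀ i, NormedSpace.exp ((t : ℂ) • T.toContinuousLinearMap) (b i) =
      Complex.exp (t * μ i) • b i := fun i =>
    exp_apply_of_apply_eq_smul (by
      rw [_root_.smul_apply, LinearMap.coe_toContinuousLinearMap', hTb, smul_smul])
  have hcoord : ∀ i, inner ℂ (b i) g = Complex.exp (t * μ i) * inner ℂ (b i) f := by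
    intro i
    have h1 : g = ∑ j, (inner ℂ (b j) f * Complex.exp (t * μ j)) • b j := by
      rw [hg]
      conv_lhs => rw [← b.sum_repr' f]
      rw [map_sum]
      refine Finset.sum_congr rfl fun j _ => ?_
      rw [map_smul, hexp, smul_smul]
    rw [h1, inner_sum, Finset.sum_eq_single i]
    · rw [inner_smul_right, orthonormal_iff_ite.1 b.orthonormal i i, if_pos rfl, mul_one,
        mul_comm]
    · intro j _ hji
      rw [inner_smul_right, orthonormal_iff_ite.1 b.orthonormal i j, if_neg hji.symm, mul_zero]
    · simp
  -- Coordinates with eigenvalue above `r` vanish by `hf`; the others shrink by at least `exp (r *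
  -- t)`. Parseval concludes.
  have hle : ∀ i, ‖inner ℂ (b i) g‖ ≤ Real.exp (r * t) * ‖inner ℂ (b i) f‖ := by
    intro i
    rw [hcoord]
    by_cases hi : r < μ i
    · rw [hf (μ i) (b i) hi (hTb i)]
      simp
    · rw [norm_mul, show (t : ℂ) * μ i = ((t * μ i : ℝ) : ℂ) by push_cast; rfl,
        ← Complex.ofReal_exp, Complex.norm_of_nonneg (Real.exp_nonneg _), mul_comm t]
      have := not_lt.1 hi
      gcongr
  refine le_of_sq_le_sq ?_ (by positivity)
  rw [mul_pow, ← b.sum_sq_norm_inner_right g, ← b.sum_sq_norm_inner_right f, Finset.mul_sum]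
  refine Finset.sum_le_sum fun i _ => ?_
  rw [← mul_pow]
  exact pow_le_pow_left₀ (norm_nonneg _) (hle i) 2

/-- An eigenvector whose eigenvalue exceeds all but one element of an eigenvalue list
is a multiple of the remaining element of the eigenbasis. -/
theorem eq_smul_eigenvectorBasis {n : ℕ} {T : E →ₗ[ℂ] E} (hT : T.IsSymmetric)
    (hn : Module.finrank ℂ E = n) {μ : ℝ} {f : E} (hf : T f = (μ : ℂ) • f) (i₀ : Fin n)
    (h : ∀ i, i ≠ i₀ → hT.eigenvalues hn i < μ) :
    f = inner ℂ (hT.eigenvectorBasis hn i₀) f • hT.eigenvectorBasis hn i₀ := by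
  conv_lhs => rw [← (hT.eigenvectorBasis hn).sum_repr' f]
  refine Finset.sum_eq_single i₀ (fun i _ hi => ?_) (by simp)
  have h1 := hT (hT.eigenvectorBasis hn i) f
  rw [hT.apply_eigenvectorBasis, hf, inner_smul_left, inner_smul_right] at h1
  have h2 : ((hT.eigenvalues hn i : ℂ) - μ) * inner ℂ (hT.eigenvectorBasis hn i) f = 0 := by
    rw [sub_mul, sub_eq_zero]
    simpa using h1
  have h3 : (hT.eigenvalues hn i : ℂ) - μ ≠ 0 := by
    rw [sub_ne_zero]
    exact_mod_cast (h i hi).ne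
  rw [(mul_eq_zero.1 h2).resolve_left h3, zero_smul]

end Spectral

/-! ### Dirichlet form, harmonic functions and the gap of graph Laplacians -/

namespace WeightedGraph

variable {V : Type*}

theorem edgeWeight_nonneg (G : WeightedGraph V) (e : Sym2 V) : 0 ≤ G.μ e := by
  by_cases h : e ∈ G.graph.edgeSet
  · exact (G.μ_pos e h).le
  · exact (G.μ_zero e h).ge

theorem weightedOne_ne_zero [Nontrivial V] (m : VertexWeight V) : WeightedL2.one m ≠ 0 := by
  intro h
  obtain ⟨v⟩ := (inferInstance : Nonempty V)
  have : (1 : ℂ) = 0 := congrFun (congrArg WeightedL2.val h) v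
  simp at this

variable [Fintype V]

theorem laplacianOn_one (G : WeightedGraph V) (m : VertexWeight V) :
    G.laplacianOn m (WeightedL2.one m) = 0 := by
  classical
  ext v
  change (1 / (G.m.wt v : ℂ)) * ∑ w with G.graph.Adj v w, (G.μ s(v, w) : ℂ) * ((1 : ℂ) - 1) = 0
  simp

/-- The Dirichlet form of the Laplacian. -/
theorem inner_laplacianOn (G : WeightedGraph V) (f : WeightedL2 G.m) :
    2 * inner ℂ f (G.laplacianOn G.m f) =
      -((∑ v, ∑ w, G.μ s(v, w) * Complex.normSq (f.val w - f.val v) : ℝ) : ℂ) := by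
  classical
  have key : inner ℂ f (G.laplacianOn G.m f) =
      ∑ v, ∑ w, (G.μ s(v, w) : ℂ) * (conj (f.val v) * (f.val w - f.val v)) := by
    rw [WeightedL2.inner_def]
    refine Finset.sum_congr rfl fun v _ => ?_
    have hm : (G.m.wt v : ℂ) ≠ 0 := by exact_mod_cast (G.m.pos v).ne'
    change (G.m.wt v : ℂ) * (_ * ((1 / (G.m.wt v : ℂ)) * _)) = _
    rw [mul_left_comm (conj (f.val v)), ← mul_assoc, mul_one_div_cancel hm, one_mul,
      Finset.sum_filter, Finset.mul_sum]
    refine Finset.sum_congr rfl fun w _ => ?_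
    split_ifs with h
    · ring
    · rw [G.μ_zero s(v, w) (by simpa using h)]
      simp
  -- Exchanging the roles of `v` and `w` symmetrises the form; adding both versions yields `-|f w -
  -- f v| ^ 2`.
  have key' : inner ℂ f (G.laplacianOn G.m f) =
      ∑ v, ∑ w, (G.μ s(v, w) : ℂ) * (conj (f.val w) * (f.val v - f.val w)) := by
    rw [key, Finset.sum_comm]
    refine Finset.sum_congr rfl fun v _ => Finset.sum_congr rfl fun w _ => ?_
    rw [Sym2.eq_swap]
  rw [two_mul]
  nth_rewrite 1 [key]
  rw [key', ← Finset.sum_add_distrib]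
  push_cast
  rw [← Finset.sum_neg_distrib]
  refine Finset.sum_congr rfl fun v _ => ?_
  rw [← Finset.sum_add_distrib, ← Finset.sum_neg_distrib]
  refine Finset.sum_congr rfl fun w _ => ?_
  rw [← Complex.mul_conj, map_sub]
  ring

/-- The eigenvalues of the Laplacian are nonpositive. -/
theorem eigenvalue_nonpos (G : WeightedGraph V) {f : WeightedL2 G.m} {μ : ℝ} (hf : f ≠ 0)
    (h : G.laplacianOn G.m f = (μ : ℂ) • f) : μ ≤ 0 := by
  have h1 := G.inner_laplacianOn f
  rw [h, inner_smul_right, inner_self_eq_norm_sq_to_K] at h1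
  have h2 : 2 * (μ * ‖f‖ ^ 2) =
      -∑ v, ∑ w, G.μ s(v, w) * Complex.normSq (f.val w - f.val v) := by
    apply Complex.ofReal_injective
    rw [Complex.ofReal_neg, ← h1]
    push_cast
    rfl
  have h3 : 0 ≤ ∑ v, ∑ w, G.μ s(v, w) * Complex.normSq (f.val w - f.val v) :=
    Finset.sum_nonneg fun v _ => Finset.sum_nonneg fun w _ =>
      mul_nonneg (G.edgeWeight_nonneg _) (Complex.normSq_nonneg _)
  have h4 : 0 < ‖f‖ ^ 2 := by
    have := norm_pos_iff.2 hf
    positivity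
  by_contra! hμ
  have := mul_pos hμ h4
  linarith

/-- On a connected graph only the constants are harmonic. -/
theorem eq_smul_one_of_laplacianOn_eq_zero (G : WeightedGraph V) (hG : G.graph.Connected)
    {f : WeightedL2 G.m} (h : G.laplacianOn G.m f = 0) :
    ∃ c : ℂ, f = c • WeightedL2.one G.m := by
  have h1 := G.inner_laplacianOn f
  rw [h, inner_zero_right, mul_zero] at h1
  have h2 : ∑ v, ∑ w, G.μ s(v, w) * Complex.normSq (f.val w - f.val v) = 0 := by
    have := neg_eq_zero.1 h1.symm
    exact_mod_cast this
  have hnn : ∀ v w, 0 ≤ G.μ s(v, w) * Complex.normSq (f.val w - f.val v) := fun v w =>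
    mul_nonneg (G.edgeWeight_nonneg _) (Complex.normSq_nonneg _)
  have hadj : ∀ v w, G.graph.Adj v w → f.val v = f.val w := by
    intro v w hvw
    have h3 := (Finset.sum_eq_zero_iff_of_nonneg fun v _ =>
      Finset.sum_nonneg fun w _ => hnn v w).1 h2 v (Finset.mem_univ v)
    have h4 := (Finset.sum_eq_zero_iff_of_nonneg fun w _ => hnn v w).1 h3 w (Finset.mem_univ w)
    have h5 := (mul_eq_zero.1 h4).resolve_left (G.μ_pos s(v, w) hvw).ne'
    exact (sub_eq_zero.1 (Complex.normSq_eq_zero.1 h5)).symm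
  have hwalk : ∀ v w, G.graph.Walk v w → f.val v = f.val w := by
    intro v w p
    induction p with
    | nil => rfl
    | cons hvw _ ih => exact (hadj _ _ hvw).trans ih
  obtain ⟨v₀⟩ := hG.nonempty
  refine ⟨f.val v₀, ?_⟩
  ext v
  obtain ⟨p⟩ := hG.preconnected v v₀
  simpa [WeightedL2.one] using hwalk v v₀ p

section Projector

variable (G : WeightedGraph V) (m : VertexWeight V)

theorem laplacianOn_comp_constProj :
    (G.laplacianOn m).toContinuousLinearMap * WeightedL2.constProj m = 0 := by
  ext1 f
  obtain ⟨c, hc⟩ := Submodule.mem_span_singleton.1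
    ((Submodule.span ℂ {WeightedL2.one m}).starProjection_apply_mem f)
  change G.laplacianOn m ((Submodule.span ℂ {WeightedL2.one m}).starProjection f) = 0
  rw [← hc, map_smul, laplacianOn_one, smul_zero]

/-- Symmetry moves the Laplacian onto the constant function, so its range is orthogonal to the
constants in the common space. -/
theorem constProj_comp_laplacianOn (hm : (G.laplacianOn m).IsSymmetric) :
    WeightedL2.constProj m * (G.laplacianOn m).toContinuousLinearMap = 0 := by
  ext1 f
  change (Submodule.span ℂ {WeightedL2.one m}).starProjection (G.laplacianOn m f) = 0
  rw [Submodule.starProjection_apply_eq_zero_iff, Submodule.mem_orthogonal_singleton_iff_inner_right,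
    ← hm, laplacianOn_one, inner_zero_left]

theorem constProj_mul_self : WeightedL2.constProj m * WeightedL2.constProj m =
    WeightedL2.constProj m :=
  (Submodule.span ℂ {WeightedL2.one m}).isIdempotentElem_starProjection

end Projector

variable [Nontrivial V]

theorem eigenvalues_le_lambda₂ (G : WeightedGraph V) {i : Fin (Fintype.card V)}
    (hi : i ≠ ⟨0, Fintype.card_pos⟩) :
    G.laplacianOn_isSymmetric.eigenvalues (WeightedL2.finrank_eq G.m) i ≤ G.lambda₂ := by
  refine G.laplacianOn_isSymmetric.eigenvalues_antitone (WeightedL2.finrank_eq G.m) ?_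
  have : (i : ℕ) ≠ 0 := fun h => hi (Fin.ext h)
  exact Fin.mk_le_of_le_val (by omega)

/-- The eigenfunctions of the Laplacian with an eigenvalue above `λ₂` are constant. -/
theorem eq_smul_one_of_lambda₂_lt (G : WeightedGraph V) {f : WeightedL2 G.m} {μ : ℝ}
    (hμ : G.lambda₂ < μ) (h : G.laplacianOn G.m f = (μ : ℂ) • f) :
    ∃ c : ℂ, f = c • WeightedL2.one G.m := by
  by_cases hf : f = 0
  · exact ⟨0, by rw [hf, zero_smul]⟩
  have hμ0 := G.eigenvalue_nonpos hf h
  set b := G.laplacianOn_isSymmetric.eigenvectorBasis (WeightedL2.finrank_eq G.m)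
  have h1 := eq_smul_eigenvectorBasis G.laplacianOn_isSymmetric (WeightedL2.finrank_eq G.m) h
    ⟨0, Fintype.card_pos⟩ fun i hi => (G.eigenvalues_le_lambda₂ hi).trans_lt hμ
  -- Since `λ₂ < μ ≤ 0`, the constant function also has an eigenvalue above `λ₂`; it and `f` are
  -- therefore multiples of the same basis vector.
  have h2 := eq_smul_eigenvectorBasis G.laplacianOn_isSymmetric (WeightedL2.finrank_eq G.m)
    (f := WeightedL2.one G.m) (μ := 0) (by rw [laplacianOn_one, Complex.ofReal_zero, zero_smul])
    ⟨0, Fintype.card_pos⟩ fun i hi => (G.eigenvalues_le_lambda₂ hi).trans_lt (hμ.trans_le hμ0)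
  change f = inner ℂ (b ⟨0, Fintype.card_pos⟩) f • b ⟨0, Fintype.card_pos⟩ at h1
  change WeightedL2.one G.m = inner ℂ (b ⟨0, Fintype.card_pos⟩) (WeightedL2.one G.m) •
    b ⟨0, Fintype.card_pos⟩ at h2
  set c := inner ℂ (b ⟨0, Fintype.card_pos⟩) (WeightedL2.one G.m) with hc
  have hc0 : c ≠ 0 := fun h0 => weightedOne_ne_zero G.m (by rw [h2, h0, zero_smul])
  refine ⟨inner ℂ (b ⟨0, Fintype.card_pos⟩) f * c⁻¹, ?_⟩
  rw [h2, smul_smul, mul_assoc, inv_mul_cancel₀ hc0, mul_one]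
  exact h1

theorem lambda₂_nonpos (G : WeightedGraph V) : G.lambda₂ ≤ 0 :=
  G.eigenvalue_nonpos ((G.laplacianOn_isSymmetric.eigenvectorBasis
    (WeightedL2.finrank_eq G.m)).orthonormal.ne_zero ⟨1, Fintype.one_lt_card⟩)
    (G.laplacianOn_isSymmetric.apply_eigenvectorBasis (WeightedL2.finrank_eq G.m) _)

/-- The Laplacian of a connected graph has a spectral gap. -/
theorem lambda₂_neg (G : WeightedGraph V) (hG : G.graph.Connected) : G.lambda₂ < 0 := by
  refine G.lambda₂_nonpos.lt_of_ne fun h0 => ?_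
  set b := G.laplacianOn_isSymmetric.eigenvectorBasis (WeightedL2.finrank_eq G.m) with hb
  set i₀ : Fin (Fintype.card V) := ⟨0, Fintype.card_pos⟩
  set i₁ : Fin (Fintype.card V) := ⟨1, Fintype.one_lt_card⟩
  have hb0 : ∀ i, b i ≠ 0 := fun i => b.orthonormal.ne_zero i
  -- If `λ₂ = 0`, the first two basis vectors are harmonic, hence constant, which contradicts their
  -- orthogonality.
  have hconst : ∀ i, i ≤ i₁ → ∃ c : ℂ, b i = c • WeightedL2.one G.m := by
    intro i hi
    have h1 := G.laplacianOn_isSymmetric.apply_eigenvectorBasis (WeightedL2.finrank_eq G.m) i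
    have h2 : G.laplacianOn_isSymmetric.eigenvalues (WeightedL2.finrank_eq G.m) i ≤ 0 :=
      G.eigenvalue_nonpos (hb0 i) h1
    have h3 : G.lambda₂ ≤ _ :=
      G.laplacianOn_isSymmetric.eigenvalues_antitone (WeightedL2.finrank_eq G.m) hi
    rw [h0] at h3
    refine G.eq_smul_one_of_laplacianOn_eq_zero hG ?_
    rw [hb, h1, le_antisymm h2 h3]
    simp
  obtain ⟨c₀, hc₀⟩ := hconst i₀ (Fin.mk_le_of_le_val (Nat.zero_le _))
  obtain ⟨c₁, hc₁⟩ := hconst i₁ le_rfl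
  have horth : inner ℂ (b i₀) (b i₁) = 0 :=
    b.orthonormal.2 fun h => by simpa [i₀, i₁] using congrArg Fin.val h
  rw [hc₀, hc₁, inner_smul_left, inner_smul_right] at horth
  have hc₀' : conj c₀ ≠ 0 := by
    rw [Ne, map_eq_zero]
    exact fun h => hb0 i₀ (by rw [hc₀, h, zero_smul])
  have hc₁' : c₁ ≠ 0 := fun h => hb0 i₁ (by rw [hc₁, h, zero_smul])
  exact (mul_ne_zero hc₀' (mul_ne_zero hc₁' (inner_self_ne_zero.2 (weightedOne_ne_zero G.m)))) horth

/-- The heat semigroup of `G` converges to the projector with rate `λ₂`, in every weighted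
space on which the Laplacian is self-adjoint. -/
theorem norm_exp_laplacianOn_le (G : WeightedGraph V) (m : VertexWeight V)
    (hm : (G.laplacianOn m).IsSymmetric) {t : ℝ} (ht : 0 ≤ t) :
    ‖NormedSpace.exp ((t : ℂ) • (G.laplacianOn m).toContinuousLinearMap) *
      (1 - WeightedL2.constProj m)‖ ≤ Real.exp (G.lambda₂ * t) := by
  refine ContinuousLinearMap.opNorm_le_bound _ (Real.exp_nonneg _) fun f => ?_
  set K := Submodule.span ℂ {WeightedL2.one m} with hK
  have hQ : (1 - WeightedL2.constProj m) f = Kᗮ.starProjection f :=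
    (K.starProjection_orthogonal_val f).symm
  rw [mul_apply_eq_comp, hQ]
  refine (norm_exp_smul_apply_le hm (r := G.lambda₂) (fun μ v hμ hv => ?_) ht).trans
    (mul_le_mul_of_nonneg_left (Kᗮ.norm_starProjection_apply_le f) (Real.exp_nonneg _))
  -- `λ₂` is defined with the graph's own vertex weight. The eigenvalue equation does not involve
  -- the scalar product, so the same function is an eigenvector there.
  obtain ⟨c, hc⟩ := G.eq_smul_one_of_lambda₂_lt (f := ⟨v.val⟩) hμ
    (WeightedL2.ext (by have := congrArg WeightedL2.val hv; exact this))
  have hv' : v = c • WeightedL2.one m :=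
    WeightedL2.ext (by have := congrArg WeightedL2.val hc; exact this)
  rw [hv', inner_smul_left, (Submodule.mem_orthogonal_singleton_iff_inner_right).1
    (Kᗮ.starProjection_apply_mem f), mul_zero]

end WeightedGraph

end SwitchingGraphs

namespace SwitchingGraphs

/-! ### Exponential convergence of the propagator -/

section Convergence

variable {Ω : Type*} {N : ℕ}

/-- Beyond some `t₀` the exponent lies below `-β * t`; before `t₀`, `u ≤ 0` and the constant `exp
(|β| * t₀)` suffices. The absolute value covers negative `β`. -/
theorem exists_exp_bound_of_tendsto {b u : ℝ → ℝ} {α β : ℝ} (hβ : β < α)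
    (hu : ∀ t, 0 ≤ t → u t ≤ 0) (hlim : Tendsto (fun t => t⁻¹ * u t) atTop (𝓝 (-α)))
    (hb : ∀ t, 0 ≤ t → b t ≤ Real.exp (u t)) :
    ∃ C : ℝ, ∀ t : ℝ, 0 ≤ t → b t ≤ C * Real.exp (-β * t) := by
  obtain ⟨t₀, h0⟩ := eventually_atTop.1
    ((hlim.eventually_lt_const (neg_lt_neg hβ)).and (eventually_gt_atTop 0))
  have ht₀ : 0 < t₀ := (h0 t₀ le_rfl).2
  refine ⟨Real.exp (|β| * t₀), fun t ht => (hb t ht).trans ?_⟩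
  rw [← Real.exp_add, Real.exp_le_exp]
  have h3 : 0 ≤ |β| * t₀ := by positivity
  rcases le_total t₀ t with h | h
  · obtain ⟨h1, h2⟩ := h0 t h
    rw [← div_eq_inv_mul, div_lt_iff₀ h2] at h1
    linarith
  · have h1 := hu t ht
    have h2 : β * t ≤ |β| * t₀ := (mul_le_mul_of_nonneg_right (le_abs_self β) ht).trans
      (mul_le_mul_of_nonneg_left h (abs_nonneg β))
    linarith

theorem IsAdmissible.sum_mean_pos {π : Matrix (Fin N) (Fin N) ℝ} {ν : Fin N → Measure ℝ}
    {ρ : Fin N → ℝ} (hπν : IsAdmissible π ν) (hρ : IsInvariant π ρ) (j : Fin N) :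
    0 < ∑ i, ρ i * ∫ t, t ∂(ν i) :=
  Finset.sum_pos (fun i _ => mul_pos (hρ.pos hπν i) (hπν.mean_pos i)) ⟨j, Finset.mem_univ j⟩

theorem IsAdmissible.timeFraction_pos {π : Matrix (Fin N) (Fin N) ℝ} {ν : Fin N → Measure ℝ}
    {ρ : Fin N → ℝ} (hπν : IsAdmissible π ν) (hρ : IsInvariant π ρ) (j : Fin N) :
    0 < timeFraction ρ ν j :=
  div_pos (mul_pos (hρ.pos hπν j) (hπν.mean_pos j)) (hπν.sum_mean_pos hρ j)

/-- The average spectral gap is positive if one of the graphs is connected. -/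
theorem averageGap_pos {V : Type*} [Fintype V] [Nontrivial V] (G : Fin N → WeightedGraph V)
    (hconn : ∃ j, (G j).graph.Connected) {Θ : Fin N → ℝ} (hΘ : ∀ j, 0 < Θ j) :
    0 < -∑ j, (G j).lambda₂ * Θ j := by
  obtain ⟨j, hj⟩ := hconn
  rw [neg_pos]
  exact Finset.sum_neg' (fun i _ => mul_nonpos_of_nonpos_of_nonneg (G i).lambda₂_nonpos (hΘ i).le)
    ⟨j, Finset.mem_univ j, mul_neg_of_neg_of_pos ((G j).lambda₂_neg hj) (hΘ j)⟩

end Convergence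

end SwitchingGraphs

/-! ### Convergence of the random propagator -/

open SwitchingGraphs in
theorem corollary4p9
    {V : Type*} [Fintype V] [Nontrivial V] {N : ℕ}
    -- the graphs, possibly with different edges, vertex weights and edge weights
    (G : Fin N → WeightedGraph V)
    -- the underlying Hilbert space, on which all the Laplacians are self-adjoint
    (m : VertexWeight V) (hm : ∀ j, ((G j).laplacianOn m).IsSymmetric)
    -- at least one of the graphs is connected
    (hconn : ∃ j, (G j).graph.Connected)
    -- the switching process
    {Ω : Type*} [MeasurableSpace Ω] (P : Measure Ω) [IsProbabilityMeasure P]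
    (X : ℕ → Ω → Fin N) (τ : ℕ → Ω → ℝ)
    (π : Matrix (Fin N) (Fin N) ℝ) (ν : Fin N → Measure ℝ)
    (hZ : IsMarkovRenewal P X τ π ν) (hπν : IsAdmissible π ν)
    -- the invariant distribution of the embedded Markov chain
    (ρ : Fin N → ℝ) (hρ : IsInvariant π ρ) :
    -- the fraction of time spent in the state `j` tends to `Θ j`
    (∀ j, ∀ᵐ ω ∂P, Tendsto
      (fun t : ℝ => t⁻¹ * ∫ s in (0 : ℝ)..t,
        Set.indicator {s : ℝ | semiMarkov X τ s ω = j} (fun _ => (1 : ℝ)) s)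
      atTop (𝓝 (timeFraction ρ ν j))) ∧
    -- the number `α` is positive
    0 < -∑ j, (G j).lambda₂ * timeFraction ρ ν j ∧
    -- almost surely, the propagator tends to the projector in norm, with every
    -- exponential rate below `α`
    ∀ᵐ ω ∂P,
      Tendsto (fun t : ℝ =>
          propagator (fun j => ((G j).laplacianOn m).toContinuousLinearMap) X τ t ω)
        atTop (𝓝 (WeightedL2.constProj m)) ∧
      ∀ β : ℝ, β < -∑ j, (G j).lambda₂ * timeFraction ρ ν j →
        ∃ C : ℝ, ∀ t : ℝ, 0 ≤ t →
          ‖propagator (fun j => ((G j).laplacianOn m).toContinuousLinearMap) X τ t ω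
            - WeightedL2.constProj m‖ ≤ C * Real.exp (-β * t) := by
  have hlim := hZ.ae_tendsto_holding hπν hρ
  -- The connected graph serves here only to show that the index set is nonempty.
  have hM := hπν.sum_mean_pos hρ hconn.choose
  have hα := averageGap_pos G hconn (hπν.timeFraction_pos hρ)
  refine ⟨fun j => ?_, hα, ?_⟩
  · filter_upwards [hlim] with ω hω
    have hτ : ∀ n, 0 ≤ τ n ω := fun n => hZ.nonneg_τ n ω
    have hT := tendsto_regTime_atTop hM (tendsto_regTime_div hω)
    refine (tendsto_occupation_div hτ hM hω j).congr' ?_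
    filter_upwards [eventually_ge_atTop 0] with t ht
    rw [integral_indicator_eq_occupation hτ hT j ht]
  · filter_upwards [hlim] with ω hω
    have hτ : ∀ n, 0 ≤ τ n ω := fun n => hZ.nonneg_τ n ω
    have hT := tendsto_regTime_atTop hM (tendsto_regTime_div hω)
    -- All `β` are handled on one event of full measure, the one where the holding sums converge.
    have hexp : ∀ β : ℝ, β < -∑ j, (G j).lambda₂ * timeFraction ρ ν j →
        ∃ C : ℝ, ∀ t : ℝ, 0 ≤ t →
          ‖propagator (fun j => ((G j).laplacianOn m).toContinuousLinearMap) X τ t ω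
            - WeightedL2.constProj m‖ ≤ C * Real.exp (-β * t) := by
      intro β hβ
      refine exists_exp_bound_of_tendsto
        (u := fun t => ∑ i, (G i).lambda₂ * occupation X τ i t ω) hβ (fun t ht => ?_) ?_
        (fun t ht => ?_)
      · exact Finset.sum_nonpos fun i _ => mul_nonpos_of_nonpos_of_nonneg (G i).lambda₂_nonpos
          (occupation_nonneg hτ hT i ht)
      · rw [neg_neg]
        refine (tendsto_finsetSum Finset.univ fun i _ =>
          (tendsto_occupation_div hτ hM hω i).const_mul (G i).lambda₂).congr fun t => ?_
        rw [Finset.mul_sum]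
        exact Finset.sum_congr rfl fun i _ => by ring
      · exact norm_propagator_sub_le (WeightedGraph.constProj_mul_self m)
          (fun j => (G j).constProj_comp_laplacianOn m (hm j))
          (fun j => (G j).laplacianOn_comp_constProj m)
          (fun j s hs => (G j).norm_exp_laplacianOn_le m (hm j) hs) hτ
          (counting_spec hτ hT ht).1
    refine ⟨?_, hexp⟩
    obtain ⟨β, hβ0, hβ⟩ := exists_between hα
    obtain ⟨C, hC⟩ := hexp β hβ
    have hdecay : Tendsto (fun t : ℝ => C * Real.exp (-β * t)) atTop (𝓝 0) := by
      rw [← mul_zero C]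
      exact (Real.tendsto_exp_atBot.comp
        (tendsto_id.const_mul_atTop_of_neg (neg_neg_of_pos hβ0))).const_mul C
    refine tendsto_iff_norm_sub_tendsto_zero.2 (squeeze_zero' (Eventually.of_forall fun t =>
      norm_nonneg _) ?_ hdecay)
    filter_upwards [eventually_ge_atTop 0] with t ht using hC t ht
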